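/- Let $M$ be a connected smooth manifold of dimension $n$, let $\alpha=\sqrt{a_{ij}(x)y^iy^j}$ be a smooth Riemannian metric and $\beta=b_i(x)y^i$ a smooth, nowhere vanishing $1$-form on $M$, let $m\in\mathbb{R}\setminus\{0,1\}$, and let $$F=\alpha^{1-m}\beta^m$$ be the corresponding $m$-Kropina metric, defined on the tangent vectors $y$ with $\beta(y)>0$. Put $g_{ij}=\tfrac12\,\partial^2F^2/\partial y^i\partial y^j$ and, wherever $(g_{ij})$ is invertible, with inverse $(g^{ij})$, $$G^i=\tfrac14\,g^{il}\Big(\frac{\partial^2F^2}{\partial x^k\partial y^l}\,y^k-\frac{\partial F^2}{\partial x^l}\Big).$$ Suppose that one of the following two conditions holds: (i) $n\ge 3$ and $F$ is a Landsberg metric, i.e. $L_{ijk}:=-\tfrac12\,F\,\frac{\partial F}{\partial y^l}\,\frac{\partial^3G^l}{\partial y^i\partial y^j\partial y^k}=0$ in all local coordinates, at every $(x,y)$ with $\beta(y)>0$ and $\det(g_{ij})\neq0$; (ii) $n\ge 2$, $m\neq-1$ and $F$ is a Douglas metric, i.e. $D^i_{jkl}:=\frac{\partial^3}{\partial y^j\partial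 y^k\partial y^l}\Big(G^i-\frac1{n+1}\frac{\partial G^r}{\partial y^r}\,y^i\Big)=0$ in all local coordinates, at every $(x,y)$ with $\beta(y)>0$ and $\det(g_{ij})\neq0$. Let $V$ be a smooth conformal vector field of $F$, i.e. a smooth vector field on $M$ whose local flow $\varphi_t$, together with $\widetilde\varphi_t(x,y)=(\varphi_t(x),\varphi_{t*}y)$, satisfies $\widetilde\varphi_t^*F=e^{2\sigma_t}F$ (as functions on the domain $\beta>0$) for some functions $\sigma_t$ on $M$. Then $V$ is homothetic: its conformal factor $c:=\frac{d}{dt}\big|_{t=0}\sigma_t$ exists and is constant on $M$. -/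

import Mathlib

open scoped Manifold ContDiff Topology

noncomputable section

/-- The model space `ℝⁿ`. -/
abbrev Coord (n : ℕ) : Type := EuclideanSpace ℝ (Fin n)

namespace LocalFinsler

/-! ### Local coordinate calculus

A function `f x y` is a function of the position coordinates `x = (xⁱ)` and of the
fibre coordinates `y = (yⁱ)` on the tangent bundle. The function `L x y` stands for `F x y ^ 2`
in a chart. All operators below are local in `(x, y)`: on the open set where `F` is smooth and
its fundamental tensor is invertible, they do not see the values outside of it. -/

variable {n : ℕ}

/-- The partial derivative `∂f/∂xⁱ`. -/
def dX (i : Fin n) (f : Coord n → Coord n → ℝ) : Coord n → Coord n → ℝ :=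
  fun x y => fderiv ℝ (fun z => f z y) x (EuclideanSpace.single i 1)

/-- The partial derivative `∂f/∂yⁱ`. -/
def dY (i : Fin n) (f : Coord n → Coord n → ℝ) : Coord n → Coord n → ℝ :=
  fun x y => fderiv ℝ (fun w => f x w) y (EuclideanSpace.single i 1)

/-- The fundamental tensor `g_ij = ½ ∂²(F²)/∂yⁱ∂yʲ`. -/
def fundTensor (F : Coord n → Coord n → ℝ) (x y : Coord n) : Matrix (Fin n) (Fin n) ℝ :=
  Matrix.of fun i j => (1 / 2 : ℝ) * dY i (dY j fun x y => F x y ^ 2) x y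

/-- The geodesic coefficients
`Gⁱ = ¼ gⁱˡ ( ∂²(F²)/∂xᵏ∂yˡ yᵏ - ∂(F²)/∂xˡ )`. -/
def spray (F : Coord n → Coord n → ℝ) (i : Fin n) : Coord n → Coord n → ℝ :=
  fun x y => (1 / 4 : ℝ) * ∑ l, (fundTensor F x y)⁻¹ i l *
    ((∑ k, dX k (dY l fun x y => F x y ^ 2) x y * y k) - dX l (fun x y => F x y ^ 2) x y)

/-- The Landsberg tensor `L_ijk = -½ F F_{yˡ} ∂³Gˡ/∂yⁱ∂yʲ∂yᵏ`. -/
def landsbergTensor (F : Coord n → Coord n → ℝ) (i j k : Fin n) (x y : Coord n) : ℝ :=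
  -(1 / 2 : ℝ) * ∑ l, F x y * dY l F x y * dY i (dY j (dY k (spray F l))) x y

/-- The Douglas tensor
`Dⁱ_jkl = ∂³/∂yʲ∂yᵏ∂yˡ ( Gⁱ - 1/(n+1) ∂Gᵐ/∂yᵐ yⁱ )`. -/
def douglasTensor (F : Coord n → Coord n → ℝ) (i j k l : Fin n) (x y : Coord n) : ℝ :=
  dY j (dY k (dY l fun x y =>
    spray F i x y - (1 / ((n : ℝ) + 1)) * (∑ r, dY r (spray F r) x y) * y i)) x y

end LocalFinsler

section Manifold

variable {n : ℕ} {M : Type*} [TopologicalSpace M] [ChartedSpace (Coord n) M]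

/-- The expression of a function `F` on the tangent bundle in the coordinates `(xⁱ, yⁱ)` that
a chart `e` of `M` induces. -/
def inChart (e : OpenPartialHomeomorph M (Coord n))
    (F : (p : M) → TangentSpace 𝓘(ℝ, Coord n) p → ℝ) (x y : Coord n) : ℝ :=
  F (e.symm x) (mfderiv 𝓘(ℝ, Coord n) 𝓘(ℝ, Coord n) e.symm x y)

/-- Let `F` be a (possibly singular) Finsler metric that is defined and positive on the vectors
`y ∈ A p`, `p ∈ M`, only. `IsRegularPoint A F e x y` says that `(x, y)` are the coordinates in the
chart `e` of a vector in the domain of `F` at which the fundamental tensor is nondegenerate. -/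
def IsRegularPoint (A : (p : M) → Set (TangentSpace 𝓘(ℝ, Coord n) p))
    (F : (p : M) → TangentSpace 𝓘(ℝ, Coord n) p → ℝ)
    (e : OpenPartialHomeomorph M (Coord n)) (x y : Coord n) : Prop :=
  x ∈ e.target ∧ mfderiv 𝓘(ℝ, Coord n) 𝓘(ℝ, Coord n) e.symm x y ∈ A (e.symm x) ∧
    IsUnit (LocalFinsler.fundTensor (inChart e F) x y).det

/-- `F` is a Landsberg metric: its Landsberg tensor vanishes wherever it is defined,
in all smooth charts. -/
def IsLandsberg (A : (p : M) → Set (TangentSpace 𝓘(ℝ, Coord n) p))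
    (F : (p : M) → TangentSpace 𝓘(ℝ, Coord n) p → ℝ) : Prop :=
  ∀ e ∈ IsManifold.maximalAtlas 𝓘(ℝ, Coord n) ∞ M, ∀ x y : Coord n, IsRegularPoint A F e x y →
    ∀ i j k : Fin n, LocalFinsler.landsbergTensor (inChart e F) i j k x y = 0

/-- `F` is a Douglas metric: its Douglas tensor vanishes wherever it is defined,
in all smooth charts. -/
def IsDouglas (A : (p : M) → Set (TangentSpace 𝓘(ℝ, Coord n) p))
    (F : (p : M) → TangentSpace 𝓘(ℝ, Coord n) p → ℝ) : Prop :=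
  ∀ e ∈ IsManifold.maximalAtlas 𝓘(ℝ, Coord n) ∞ M, ∀ x y : Coord n, IsRegularPoint A F e x y →
    ∀ i j k l : Fin n, LocalFinsler.douglasTensor (inChart e F) i j k l x y = 0

/-- `Φ (t, x) = φ_t(x)`, defined for `(t, x) ∈ D`, is a smooth local flow of the vector field `V`.
Here `D` is an open neighbourhood of `{0} × M` whose time slices are intervals. -/
structure IsLocalFlow (V : (p : M) → TangentSpace 𝓘(ℝ, Coord n) p)
    (D : Set (ℝ × M)) (Φ : ℝ × M → M) : Prop where
  isOpen : IsOpen D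
  zero_mem : ∀ x : M, (0, x) ∈ D
  ordConnected : ∀ x : M, {t : ℝ | (t, x) ∈ D}.OrdConnected
  smooth : ContMDiffOn (𝓘(ℝ, ℝ).prod 𝓘(ℝ, Coord n)) 𝓘(ℝ, Coord n) ∞ Φ D
  map_zero : ∀ x : M, Φ (0, x) = x
  integralCurve : ∀ x : M, IsMIntegralCurveOn (fun t => Φ (t, x)) V {t : ℝ | (t, x) ∈ D}

/-- The flow `φ_t` of `V` satisfies `φ̃_t^* F = e^{2 σ_t} F`, where `φ̃_t(x, y) = (φ_t(x), φ_{t*} y)`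
and `σ_t` is a function on `M`. Both sides are functions on the domain `A` of `F`. -/
structure IsConformalFlow (A : (p : M) → Set (TangentSpace 𝓘(ℝ, Coord n) p))
    (F : (p : M) → TangentSpace 𝓘(ℝ, Coord n) p → ℝ)
    (V : (p : M) → TangentSpace 𝓘(ℝ, Coord n) p)
    (D : Set (ℝ × M)) (Φ : ℝ × M → M) (σ : ℝ → M → ℝ) : Prop where
  flow : IsLocalFlow V D Φ
  mem_iff : ∀ t x, (t, x) ∈ D → ∀ y : TangentSpace 𝓘(ℝ, Coord n) x,
    mfderiv 𝓘(ℝ, Coord n) 𝓘(ℝ, Coord n) (fun z => Φ (t, z)) x y ∈ A (Φ (t, x)) ↔ y ∈ A x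
  pullback : ∀ t x, (t, x) ∈ D → ∀ y ∈ A x,
    F (Φ (t, x)) (mfderiv 𝓘(ℝ, Coord n) 𝓘(ℝ, Coord n) (fun z => Φ (t, z)) x y)
      = Real.exp (2 * σ t x) * F x y

/-- `V` is a conformal vector field of `F`. -/
def IsConformalField (A : (p : M) → Set (TangentSpace 𝓘(ℝ, Coord n) p))
    (F : (p : M) → TangentSpace 𝓘(ℝ, Coord n) p → ℝ)
    (V : (p : M) → TangentSpace 𝓘(ℝ, Coord n) p) : Prop :=
  ∃ (D : Set (ℝ × M)) (Φ : ℝ × M → M) (σ : ℝ → M → ℝ), IsConformalFlow A F V D Φ σ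

/-- `V` is a conformal vector field of `F` with the conformal factor `c = d/dt|_{t=0} σ_t`. -/
def HasConformalFactor (A : (p : M) → Set (TangentSpace 𝓘(ℝ, Coord n) p))
    (F : (p : M) → TangentSpace 𝓘(ℝ, Coord n) p → ℝ)
    (V : (p : M) → TangentSpace 𝓘(ℝ, Coord n) p) (c : M → ℝ) : Prop :=
  ∃ (D : Set (ℝ × M)) (Φ : ℝ × M → M) (σ : ℝ → M → ℝ), IsConformalFlow A F V D Φ σ ∧
    ∀ x : M, HasDerivAt (fun t => σ t x) (c x) 0

/-- `V` is homothetic: it is a conformal vector field with constant conformal factor. -/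
def IsHomotheticField (A : (p : M) → Set (TangentSpace 𝓘(ℝ, Coord n) p))
    (F : (p : M) → TangentSpace 𝓘(ℝ, Coord n) p → ℝ)
    (V : (p : M) → TangentSpace 𝓘(ℝ, Coord n) p) : Prop :=
  ∃ c₀ : ℝ, HasConformalFactor A F V fun _ => c₀

variable [IsManifold 𝓘(ℝ, Coord n) ∞ M]

/-- A smooth vector field on `M`. -/
def IsSmoothField (V : (p : M) → TangentSpace 𝓘(ℝ, Coord n) p) : Prop :=
  ContMDiff 𝓘(ℝ, Coord n) (𝓘(ℝ, Coord n).prod 𝓘(ℝ, Coord n)) ∞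
    (fun p => (⟨p, V p⟩ : TangentBundle 𝓘(ℝ, Coord n) M))

/-- A smooth 1-form on `M`, that is, a smooth section of the cotangent bundle. -/
def IsSmoothOneForm (β : (p : M) → TangentSpace 𝓘(ℝ, Coord n) p →L[ℝ] ℝ) : Prop :=
  ContMDiff 𝓘(ℝ, Coord n) (𝓘(ℝ, Coord n).prod 𝓘(ℝ, Coord n →L[ℝ] ℝ)) ∞
    (fun p => Bundle.TotalSpace.mk' (Coord n →L[ℝ] ℝ)
      (E := fun p : M => TangentSpace 𝓘(ℝ, Coord n) p →L[ℝ] Bundle.Trivial M ℝ p) p (β p))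

/-- A smooth Riemannian metric on `M`. -/
abbrev SmoothRiemannianMetric (n : ℕ) (M : Type*) [TopologicalSpace M]
    [ChartedSpace (Coord n) M] [IsManifold 𝓘(ℝ, Coord n) ∞ M] :=
  Bundle.ContMDiffRiemannianMetric 𝓘(ℝ, Coord n) ∞ (Coord n)
    (fun p : M => TangentSpace 𝓘(ℝ, Coord n) p)

/-- The domain `β > 0` of an `m`-Kropina metric. -/
def kropinaDomain (β : (p : M) → TangentSpace 𝓘(ℝ, Coord n) p →L[ℝ] ℝ)
    (p : M) : Set (TangentSpace 𝓘(ℝ, Coord n) p) :=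
  {y | 0 < β p y}

/-- The `m`-Kropina metric `F = α^{1-m} β^m`, with `α = √(a_ij yⁱ yʲ)` and `m` a real number.
It is meaningful on `β > 0`. -/
def kropina (a : SmoothRiemannianMetric n M)
    (β : (p : M) → TangentSpace 𝓘(ℝ, Coord n) p →L[ℝ] ℝ) (m : ℝ)
    (p : M) (y : TangentSpace 𝓘(ℝ, Coord n) p) : ℝ :=
  Real.sqrt (a.inner p y y) ^ (1 - m) * (β p y) ^ m

end Manifold

end

/-! Fix a time `t` of the flow. Since `φ_t` is an immersion, composing it with the inverse of a
chart `e₀` gives locally the inverse of another chart `e` in the maximal atlas. The expressions of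
`F` in `e` and `e₀` then satisfy `f' = exp (2σ_t) f` on a common coordinate domain. The Landsberg or
Douglas condition holds in every chart, so it holds for both `f` and `f'`. It remains to prove a
pointwise rigidity statement: if conformal `m`-Kropina metrics `f` and `f' = exp(u) f` both satisfy
the condition, then `du = 0`.

The difference of the two sprays is `du(y) y - ½ F² g⁻¹ du` (`spray_conformal`). Let `bs` be the
vector dual to `β`, and let `e` be orthogonal to `bs` with the same length. On the line `y = bs + t
e` the Hessian of `F²` can be inverted by hand (`kropinaHess_solution`), and the spray difference is
a vector-valued quadratic polynomial in `t` plus a constant times `R(t) ((1 - t²) bs + 2t e)`, where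
`R = (du(bs)(1 - t²) + 2 du(e) t)/(1 - m t²)` (`spray_line`). Everything is then decided by the
rational function `R`.

For Landsberg metrics the third derivative of the spray difference is annihilated by `d(F²)`. This
is a linear differential equation for `R`. Compared with the third derivative of `R(1 - m t²)`,
which vanishes, it yields `R' = 0`, and `R` is constant only if `du(bs) = du(e) = 0`. For Douglas
metrics the spray difference is quadratic in `t` modulo a multiple of `y`. Eliminating that multiple
shows that `1 - m t²` divides `t (1 + t²)(du(bs)(1 - t²) + 2 du(e) t)`, which for `m ≠ 0, ±1` is
again possible only if both coefficients vanish. As `e` varies, `du = 0` follows.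

So `σ_t` is locally constant in space, uniformly for small `t`. Its time derivative at `0`, which
exists because `σ_t` is half the logarithm of a smooth quotient, is locally constant, hence constant
on the connected manifold. -/

noncomputable section

namespace LocalFinsler

variable {n : ℕ}

/-! ### Smoothness of the fundamental tensor and of the spray in coordinates -/

section Smoothness

variable {f g : Coord n → Coord n → ℝ} {O : Set (Coord n × Coord n)}

theorem hasFDerivAt_slice_right (hO : IsOpen O) (hf : ContDiffOn ℝ ∞ (Function.uncurry f) O)
    {x y : Coord n} (h : (x, y) ∈ O) :
    HasFDerivAt (fun w => f x w)
      ((fderiv ℝ (Function.uncurry f) (x, y)).comp (ContinuousLinearMap.inr ℝ _ _)) y := by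
  have h1 : HasFDerivAt (Function.uncurry f) (fderiv ℝ (Function.uncurry f) (x, y)) (x, y) :=
    ((hf.contDiffAt (hO.mem_nhds h)).differentiableAt (by simp)).hasFDerivAt
  exact h1.comp y (hasFDerivAt_prodMk_right x y)

theorem hasFDerivAt_slice_left (hO : IsOpen O) (hf : ContDiffOn ℝ ∞ (Function.uncurry f) O)
    {x y : Coord n} (h : (x, y) ∈ O) :
    HasFDerivAt (fun z => f z y)
      ((fderiv ℝ (Function.uncurry f) (x, y)).comp (ContinuousLinearMap.inl ℝ _ _)) x := by
  have h1 : HasFDerivAt (Function.uncurry f) (fderiv ℝ (Function.uncurry f) (x, y)) (x, y) :=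
    ((hf.contDiffAt (hO.mem_nhds h)).differentiableAt (by simp)).hasFDerivAt
  exact h1.comp (f := fun z => (z, y)) x (hasFDerivAt_prodMk_left x y)

theorem contDiffOn_dY (hO : IsOpen O) (hf : ContDiffOn ℝ ∞ (Function.uncurry f) O) (i : Fin n) :
    ContDiffOn ℝ ∞ (Function.uncurry (dY i f)) O := by
  have h1 : ContDiffOn ℝ ∞ (fun p => fderiv ℝ (Function.uncurry f) p
      ((0 : Coord n), EuclideanSpace.single i (1 : ℝ))) O :=
    (hf.fderiv_of_isOpen hO (by simp)).clm_apply contDiffOn_const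
  refine h1.congr ?_
  rintro ⟨x, y⟩ h
  simp [dY, (hasFDerivAt_slice_right hO hf h).fderiv]

theorem contDiffOn_sq (hf : ContDiffOn ℝ ∞ (Function.uncurry f) O) :
    ContDiffOn ℝ ∞ (Function.uncurry fun x y => f x y ^ 2) O :=
  hf.pow 2

theorem contDiffOn_dX (hO : IsOpen O) (hf : ContDiffOn ℝ ∞ (Function.uncurry f) O) (i : Fin n) :
    ContDiffOn ℝ ∞ (Function.uncurry (dX i f)) O := by
  have h1 : ContDiffOn ℝ ∞ (fun p => fderiv ℝ (Function.uncurry f) p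
      (EuclideanSpace.single i (1 : ℝ), (0 : Coord n))) O :=
    (hf.fderiv_of_isOpen hO (by simp)).clm_apply contDiffOn_const
  refine h1.congr ?_
  rintro ⟨x, y⟩ h
  simp [dX, (hasFDerivAt_slice_left hO hf h).fderiv]

theorem contDiffOn_fundTensor (hO : IsOpen O) (hf : ContDiffOn ℝ ∞ (Function.uncurry f) O)
    (i j : Fin n) : ContDiffOn ℝ ∞ (fun p : Coord n × Coord n => fundTensor f p.1 p.2 i j) O :=
  contDiffOn_const.mul (contDiffOn_dY hO (contDiffOn_dY hO (contDiffOn_sq hf) j) i)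

theorem contDiffOn_det {E : Type*} [NormedAddCommGroup E] [NormedSpace ℝ E] {s : Set E}
    {A : E → Matrix (Fin n) (Fin n) ℝ} (hA : ∀ i j, ContDiffOn ℝ ∞ (fun p => A p i j) s) :
    ContDiffOn ℝ ∞ (fun p => (A p).det) s := by
  simp only [Matrix.det_apply]
  exact ContDiffOn.sum fun σ _ => (contDiffOn_prod fun i _ => hA _ _).const_smul _

theorem contDiffOn_matrix_inv {E : Type*} [NormedAddCommGroup E] [NormedSpace ℝ E] {s : Set E}
    {A : E → Matrix (Fin n) (Fin n) ℝ} (hA : ∀ i j, ContDiffOn ℝ ∞ (fun p => A p i j) s)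
    (hdet : ∀ p ∈ s, IsUnit (A p).det) (i j : Fin n) :
    ContDiffOn ℝ ∞ (fun p => (A p)⁻¹ i j) s := by
  simp only [Matrix.inv_def, Matrix.smul_apply, Ring.inverse_eq_inv', smul_eq_mul,
    Matrix.adjugate_apply]
  refine ((contDiffOn_det hA).inv fun p hp => (hdet p hp).ne_zero).mul (contDiffOn_det ?_)
  intro k l
  by_cases hk : k = j
  · subst hk
    simpa using contDiffOn_const
  · simpa [Matrix.updateRow_ne hk] using hA k l

/-- The points of `O` at which the fundamental tensor is nondegenerate. -/
def regularSet (f : Coord n → Coord n → ℝ) (O : Set (Coord n × Coord n)) :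
    Set (Coord n × Coord n) :=
  {p ∈ O | IsUnit (fundTensor f p.1 p.2).det}

theorem isOpen_regularSet (hO : IsOpen O) (hf : ContDiffOn ℝ ∞ (Function.uncurry f) O) :
    IsOpen (regularSet f O) := by
  have h : regularSet f O = O ∩ (fun p => (fundTensor f p.1 p.2).det) ⁻¹' {0}ᶜ :=
    Set.ext fun p => and_congr_right fun _ => isUnit_iff_ne_zero
  rw [h]
  exact (contDiffOn_det (contDiffOn_fundTensor hO hf)).continuousOn.isOpen_inter_preimage hO
    isOpen_compl_singleton

theorem contDiffOn_spray (hO : IsOpen O) (hf : ContDiffOn ℝ ∞ (Function.uncurry f) O)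
    (i : Fin n) : ContDiffOn ℝ ∞ (Function.uncurry (spray f i)) (regularSet f O) := by
  have hsub : regularSet f O ⊆ O := fun p hp => hp.1
  have hR := isOpen_regularSet hO hf
  have hf' := hf.mono hsub
  refine contDiffOn_const.mul (ContDiffOn.sum fun l _ => ?_)
  refine (contDiffOn_matrix_inv (contDiffOn_fundTensor hR hf') (fun p hp => hp.2) i l).mul ?_
  refine ContDiffOn.sub (ContDiffOn.sum fun k _ => ?_) (contDiffOn_dX hR (contDiffOn_sq hf') l)
  refine (contDiffOn_dX hR (contDiffOn_dY hR (contDiffOn_sq hf') l) k).mul ?_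
  exact ((EuclideanSpace.proj k : Coord n →L[ℝ] ℝ).contDiff.comp contDiff_snd).contDiffOn

end Smoothness

/-! ### Conformal change of the fundamental tensor and of the spray -/

section Conformal

variable {f f' : Coord n → Coord n → ℝ} {O : Set (Coord n × Coord n)} {u : Coord n → ℝ}

/-- A factor depending on `x` alone is a constant for fibre derivatives, so no differentiability of
`h` or `c` is needed. -/
theorem dY_congr (hO : IsOpen O) {g h : Coord n → Coord n → ℝ} {c : Coord n → ℝ}
    (hgh : ∀ p ∈ O, g p.1 p.2 = c p.1 * h p.1 p.2) (i : Fin n) {p : Coord n × Coord n}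
    (hp : p ∈ O) : dY i g p.1 p.2 = c p.1 * dY i h p.1 p.2 := by
  have h1 : (fun w => g p.1 w) =ᶠ[𝓝 p.2] fun w => c p.1 • h p.1 w := by
    have : ∀ᶠ w in 𝓝 p.2, (p.1, w) ∈ O :=
      (Continuous.prodMk_right p.1).continuousAt.eventually_mem (hO.mem_nhds hp)
    filter_upwards [this] with w hw using hgh _ hw
  simp only [dY]
  rw [h1.fderiv_eq, show (fun w => c p.1 • h p.1 w) = c p.1 • fun w => h p.1 w from rfl,
    fderiv_const_smul_field]
  simp

theorem dX_congr (hO : IsOpen O) {g h : Coord n → Coord n → ℝ} {c : Coord n → ℝ}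
    (hgh : ∀ p ∈ O, g p.1 p.2 = c p.1 * h p.1 p.2) (i : Fin n) {x y : Coord n}
    (hp : (x, y) ∈ O) (hc : DifferentiableAt ℝ c x) (hh : ContDiffOn ℝ ∞ (Function.uncurry h) O) :
    dX i g x y = c x * dX i h x y +
      h x y * fderiv ℝ c x (EuclideanSpace.single i 1) := by
  have h1 : (fun z => g z y) =ᶠ[𝓝 x] fun z => c z * h z y := by
    have : ∀ᶠ z in 𝓝 x, (z, y) ∈ O :=
      (Continuous.prodMk_left y).continuousAt.eventually_mem (hO.mem_nhds hp)
    filter_upwards [this] with w hw using hgh _ hw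
  simp only [dX]
  rw [h1.fderiv_eq, fderiv_fun_mul hc (hasFDerivAt_slice_left hO hh hp).differentiableAt]
  simp

theorem sq_conformal (hff : ∀ p ∈ O, f' p.1 p.2 = Real.exp (u p.1) * f p.1 p.2) :
    ∀ p ∈ O, f' p.1 p.2 ^ 2 = Real.exp (2 * u p.1) * f p.1 p.2 ^ 2 := by
  intro p hp
  rw [hff p hp, mul_pow, ← Real.exp_nat_mul]
  norm_num

theorem fundTensor_conformal (hO : IsOpen O)
    (hff : ∀ p ∈ O, f' p.1 p.2 = Real.exp (u p.1) * f p.1 p.2)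
    {x y : Coord n} (hp : (x, y) ∈ O) :
    fundTensor f' x y = Real.exp (2 * u x) • fundTensor f x y := by
  have h1 := fun j => fun p hp => dY_congr hO (c := fun x => Real.exp (2 * u x))
    (g := fun x y => f' x y ^ 2) (h := fun x y => f x y ^ 2) (sq_conformal hff) j (p := p) hp
  ext i j
  have h2 := dY_congr hO (g := dY j fun x y => f' x y ^ 2) (h := dY j fun x y => f x y ^ 2)
    (c := fun x => Real.exp (2 * u x)) (h1 j) i hp
  simp only [fundTensor, Matrix.of_apply, Matrix.smul_apply, smul_eq_mul] at *
  rw [h2]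
  ring

theorem isUnit_fundTensor_conformal (hO : IsOpen O)
    (hff : ∀ p ∈ O, f' p.1 p.2 = Real.exp (u p.1) * f p.1 p.2)
    {x y : Coord n} (hp : (x, y) ∈ O) (h : IsUnit (fundTensor f x y).det) :
    IsUnit (fundTensor f' x y).det := by
  rw [fundTensor_conformal hO hff hp, Matrix.det_smul]
  exact (((Real.exp_ne_zero _).isUnit).pow _).mul h

/-- The change of the geodesic coefficients under a conformal change of the metric. -/
theorem spray_conformal (hO : IsOpen O) (hf : ContDiffOn ℝ ∞ (Function.uncurry f) O)
    (hff : ∀ p ∈ O, f' p.1 p.2 = Real.exp (u p.1) * f p.1 p.2)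
    {x y : Coord n} (hp : (x, y) ∈ O) (hu : DifferentiableAt ℝ u x)
    (h : IsUnit (fundTensor f x y).det) (S : Fin n → ℝ)
    (hS : ∀ j, ∑ l, fundTensor f x y j l * S l = (1 / 2) *
      (fderiv ℝ u x y * dY j (fun x y => f x y ^ 2) x y
        - fderiv ℝ u x (EuclideanSpace.single j 1) * f x y ^ 2)) (i : Fin n) :
    spray f' i x y = spray f i x y + S i := by
  have hsq : ContDiffOn ℝ ∞ (Function.uncurry fun x y => f x y ^ 2) O := contDiffOn_sq hf
  have hc : HasFDerivAt (fun x => Real.exp (2 * u x))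
      (Real.exp (2 * u x) • ((2 : ℝ) • fderiv ℝ u x)) x :=
    (hu.hasFDerivAt.const_mul 2).exp
  have h1 := fun j => fun p hp => dY_congr hO (c := fun x => Real.exp (2 * u x))
    (g := fun x y => f' x y ^ 2) (h := fun x y => f x y ^ 2) (sq_conformal hff) j (p := p) hp
  have h2 := fun k l => dX_congr hO (g := dY l fun x y => f' x y ^ 2)
    (h := dY l fun x y => f x y ^ 2) (c := fun x => Real.exp (2 * u x)) (h1 l) k hp
    hc.differentiableAt (contDiffOn_dY hO hsq l)
  have h3 := fun k => dX_congr hO (c := fun x => Real.exp (2 * u x))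
    (g := fun x y => f' x y ^ 2) (h := fun x y => f x y ^ 2) (sq_conformal hff) k hp
    hc.differentiableAt hsq
  have hinv : (fundTensor f' x y)⁻¹ = (Real.exp (2 * u x))⁻¹ • (fundTensor f x y)⁻¹ := by
    rw [fundTensor_conformal hO hff hp]
    exact Matrix.inv_smul' _ (Units.mk0 _ (Real.exp_ne_zero _)) h
  have hy : fderiv ℝ u x y = ∑ k, y k * fderiv ℝ u x (EuclideanSpace.single k 1) := by
    conv_lhs => rw [← (EuclideanSpace.basisFun (Fin n) ℝ).sum_repr y]
    simp
  have hSi : S i = ∑ l, (fundTensor f x y)⁻¹ i l * ((1 / 2) *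
      (fderiv ℝ u x y * dY l (fun x y => f x y ^ 2) x y
        - fderiv ℝ u x (EuclideanSpace.single l 1) * f x y ^ 2)) := by
    have : S = (fundTensor f x y)⁻¹.mulVec ((fundTensor f x y).mulVec S) := by
      rw [Matrix.mulVec_mulVec, Matrix.nonsing_inv_mul _ h, Matrix.one_mulVec]
    conv_lhs => rw [this]
    simp only [Matrix.mulVec, dotProduct, hS]
  rw [hSi]
  simp only [spray]
  rw [Finset.mul_sum, Finset.mul_sum, ← Finset.sum_add_distrib]
  refine Finset.sum_congr rfl fun l _ => ?_
  simp only [h2, h3, hinv, hc.fderiv]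
  have hsum : ∑ k, (Real.exp (2 * u x) * dX k (dY l fun x y => f x y ^ 2) x y +
      dY l (fun x y => f x y ^ 2) x y *
        (Real.exp (2 * u x) • ((2 : ℝ) • fderiv ℝ u x)) (EuclideanSpace.single k 1)) * y k =
      Real.exp (2 * u x) * ∑ k, dX k (dY l fun x y => f x y ^ 2) x y * y k +
      2 * Real.exp (2 * u x) * dY l (fun x y => f x y ^ 2) x y * fderiv ℝ u x y := by
    rw [hy, Finset.mul_sum, Finset.mul_sum, ← Finset.sum_add_distrib]
    refine Finset.sum_congr rfl fun k _ => ?_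
    simp
    ring
  rw [hsum]
  have he := Real.exp_ne_zero (2 * u x)
  simp only [Matrix.smul_apply, smul_eq_mul, smul_apply]
  field_simp
  ring

end Conformal

/-! ### Algebra of an `m`-Kropina norm on a single tangent space -/

/-- The square of an `m`-Kropina norm on a vector space. -/
def kropinaSq (a : Coord n →L[ℝ] Coord n →L[ℝ] ℝ) (b : Coord n →L[ℝ] ℝ) (m : ℝ)
    (y : Coord n) : ℝ :=
  (a y y) ^ (1 - m) * (b y) ^ (2 * m)

/-- The logarithmic derivative of `kropinaSq`. -/
def kropinaLogDeriv (a : Coord n →L[ℝ] Coord n →L[ℝ] ℝ) (b : Coord n →L[ℝ] ℝ) (m : ℝ)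
    (y w : Coord n) : ℝ :=
  2 * (1 - m) * a y w / a y y + 2 * m * b w / b y

/-- The Hessian of `kropinaSq`. -/
def kropinaHess (a : Coord n →L[ℝ] Coord n →L[ℝ] ℝ) (b : Coord n →L[ℝ] ℝ) (m : ℝ)
    (y v w : Coord n) : ℝ :=
  kropinaSq a b m y * (kropinaLogDeriv a b m y v * kropinaLogDeriv a b m y w +
    2 * (1 - m) * (a v w / a y y - 2 * a y v * a y w / a y y ^ 2) - 2 * m * b v * b w / b y ^ 2)

section Fibre

variable {a : Coord n →L[ℝ] Coord n →L[ℝ] ℝ} {b : Coord n →L[ℝ] ℝ} {m : ℝ}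

theorem kropinaSq_pos (hpos : ∀ v, v ≠ 0 → 0 < a v v) {y : Coord n} (hy : 0 < b y) :
    0 < kropinaSq a b m y := by
  have hA : 0 < a y y := hpos y (by rintro rfl; simp at hy)
  unfold kropinaSq
  positivity

theorem sq_kropina_eq (hpos : ∀ v, v ≠ 0 → 0 < a v v) {y : Coord n} (hy : 0 < b y) :
    (Real.sqrt (a y y) ^ (1 - m) * b y ^ m) ^ 2 = kropinaSq a b m y := by
  have hA : 0 < a y y := hpos y (by rintro rfl; simp at hy)
  rw [kropinaSq, mul_pow, Real.sqrt_eq_rpow, ← Real.rpow_mul hA.le, ← Real.rpow_mul_natCast hA.le,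
    ← Real.rpow_mul_natCast hy.le]
  congr 2 <;> push_cast <;> ring

theorem hasFDerivAt_quadratic (hsymm : ∀ v w, a v w = a w v) (y : Coord n) :
    HasFDerivAt (fun y => a y y) ((2 : ℝ) • a y) y := by
  have h := a.hasFDerivAt (x := y) |>.clm_apply (hasFDerivAt_id y)
  refine h.congr_fderiv ?_
  ext v
  simp [hsymm v y]
  ring

theorem hasFDerivAt_kropinaSq (hsymm : ∀ v w, a v w = a w v) (hpos : ∀ v, v ≠ 0 → 0 < a v v)
    {y : Coord n} (hy : 0 < b y) :
    HasFDerivAt (kropinaSq a b m)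
      (kropinaSq a b m y • ((2 * (1 - m) / a y y) • a y + (2 * m / b y) • b)) y := by
  have hA : 0 < a y y := hpos y (by rintro rfl; simp at hy)
  have h1 := (hasFDerivAt_quadratic hsymm y).rpow_const (p := 1 - m) (Or.inl hA.ne')
  have h2 := (b.hasFDerivAt (x := y)).rpow_const (p := 2 * m) (Or.inl hy.ne')
  refine (h1.mul h2).congr_fderiv ?_
  ext v
  simp only [kropinaSq, add_apply, smul_apply, smul_eq_mul]
  rw [Real.rpow_sub_one hA.ne', Real.rpow_sub_one hy.ne']
  field_simp
  ring

theorem hasFDerivAt_kropinaLogDeriv (hsymm : ∀ v w, a v w = a w v)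
    (hpos : ∀ v, v ≠ 0 → 0 < a v v) {y : Coord n} (hy : 0 < b y) (w : Coord n) :
    HasFDerivAt (fun y => kropinaLogDeriv a b m y w)
      ((2 * (1 - m) / a y y) • a w - (4 * (1 - m) * a y w / a y y ^ 2) • a y -
        (2 * m * b w / b y ^ 2) • b) y := by
  have hA : 0 < a y y := hpos y (by rintro rfl; simp at hy)
  have h1 := ((a.flip w).hasFDerivAt (x := y)).const_mul (2 * (1 - m))
  have h2 := h1.mul (HasDerivAt.comp_hasFDerivAt (f := fun y => a y y) y
    (hasDerivAt_inv hA.ne') (hasFDerivAt_quadratic hsymm y))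
  have h3 := ((hasDerivAt_inv hy.ne').comp_hasFDerivAt y (b.hasFDerivAt (x := y))).const_mul
    (2 * m * b w)
  refine (h2.add h3).congr_fderiv ?_
  ext v
  simp [hsymm v w]
  field_simp
  ring

variable {f : Coord n → Coord n → ℝ} {x : Coord n}

theorem eventually_sq_eq (hpos : ∀ v, v ≠ 0 → 0 < a v v)
    (hf : ∀ y, 0 < b y → f x y = Real.sqrt (a y y) ^ (1 - m) * b y ^ m) {y : Coord n}
    (hy : 0 < b y) : (fun w => f x w ^ 2) =ᶠ[𝓝 y] kropinaSq a b m := by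
  have : ∀ᶠ w in 𝓝 y, 0 < b w := b.continuous.continuousAt.eventually_mem (Ioi_mem_nhds hy)
  filter_upwards [this] with w hw
  rw [hf w hw, sq_kropina_eq hpos hw]

theorem dY_sq_kropina (hsymm : ∀ v w, a v w = a w v) (hpos : ∀ v, v ≠ 0 → 0 < a v v)
    (hf : ∀ y, 0 < b y → f x y = Real.sqrt (a y y) ^ (1 - m) * b y ^ m) {y : Coord n}
    (hy : 0 < b y) (j : Fin n) :
    dY j (fun x y => f x y ^ 2) x y =
      kropinaSq a b m y * kropinaLogDeriv a b m y (EuclideanSpace.single j 1) := by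
  simp only [dY]
  rw [(eventually_sq_eq hpos hf hy).fderiv_eq, (hasFDerivAt_kropinaSq hsymm hpos hy).fderiv]
  simp only [kropinaLogDeriv, add_apply, smul_apply, smul_eq_mul]
  ring

theorem fundTensor_kropina (hsymm : ∀ v w, a v w = a w v) (hpos : ∀ v, v ≠ 0 → 0 < a v v)
    (hf : ∀ y, 0 < b y → f x y = Real.sqrt (a y y) ^ (1 - m) * b y ^ m) {y : Coord n}
    (hy : 0 < b y) (i j : Fin n) :
    fundTensor f x y i j = (1 / 2) *
      kropinaHess a b m y (EuclideanSpace.single i 1) (EuclideanSpace.single j 1) := by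
  have h1 : (fun w => dY j (fun x y => f x y ^ 2) x w) =ᶠ[𝓝 y] fun y =>
      kropinaSq a b m y * kropinaLogDeriv a b m y (EuclideanSpace.single j 1) := by
    have : ∀ᶠ w in 𝓝 y, 0 < b w := b.continuous.continuousAt.eventually_mem (Ioi_mem_nhds hy)
    filter_upwards [this] with w hw using dY_sq_kropina hsymm hpos hf hw j
  have h2 := (hasFDerivAt_kropinaSq (m := m) hsymm hpos hy).fun_mul
    (hasFDerivAt_kropinaLogDeriv (m := m) hsymm hpos hy (EuclideanSpace.single j 1))
  simp only [fundTensor, Matrix.of_apply]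
  rw [dY, h1.fderiv_eq, h2.fderiv]
  simp only [kropinaHess, kropinaLogDeriv, add_apply, smul_apply, sub_apply, smul_eq_mul,
    hsymm (EuclideanSpace.single j 1) (EuclideanSpace.single i 1)]
  ring

theorem exists_kropinaHess_eq (y v : Coord n) :
    ∃ φ : Coord n →L[ℝ] ℝ, ∀ w, kropinaHess a b m y v w = φ w := by
  refine ⟨kropinaSq a b m y • (kropinaLogDeriv a b m y v •
    ((2 * (1 - m) / a y y) • a y + (2 * m / b y) • b) + (2 * (1 - m) / a y y) • a v -
    (4 * (1 - m) * a y v / a y y ^ 2) • a y - (2 * m * b v / b y ^ 2) • b), fun w => ?_⟩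
  simp only [kropinaHess, kropinaLogDeriv, add_apply, smul_apply, sub_apply, smul_eq_mul]
  ring

theorem sum_apply_single (φ : Coord n →L[ℝ] ℝ) (v : Coord n) :
    ∑ l, φ (EuclideanSpace.single l 1) * v l = φ v := by
  have hv : v = ∑ l, v l • EuclideanSpace.single l (1 : ℝ) := by
    conv_lhs => rw [← (EuclideanSpace.basisFun (Fin n) ℝ).sum_repr v]
    simp
  conv_rhs => rw [hv, map_sum]
  exact Finset.sum_congr rfl fun l _ => by simp [mul_comm]

theorem kropinaHess_sum (y v T : Coord n) :
    ∑ l, kropinaHess a b m y v (EuclideanSpace.single l 1) * T l = kropinaHess a b m y v T := by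
  obtain ⟨φ, hφ⟩ := exists_kropinaHess_eq (a := a) (b := b) (m := m) y v
  simp only [hφ, sum_apply_single]

/-- This is Euler's identity for the 1-homogeneous first derivative of `F²`. It accounts for the
`du(y) y` part of the spray difference. -/
theorem kropinaHess_self (hsymm : ∀ v w, a v w = a w v) (hpos : ∀ v, v ≠ 0 → 0 < a v v)
    {y : Coord n} (hy : 0 < b y) (v : Coord n) :
    kropinaHess a b m y v y = kropinaSq a b m y * kropinaLogDeriv a b m y v := by
  have hA : 0 < a y y := hpos y (by rintro rfl; simp at hy)
  simp only [kropinaHess, kropinaLogDeriv, hsymm v y]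
  field_simp
  ring

theorem sum_fundTensor_kropina (hsymm : ∀ v w, a v w = a w v) (hpos : ∀ v, v ≠ 0 → 0 < a v v)
    (hf : ∀ y, 0 < b y → f x y = Real.sqrt (a y y) ^ (1 - m) * b y ^ m) {y : Coord n}
    (hy : 0 < b y) (j : Fin n) (T : Coord n) :
    ∑ l, fundTensor f x y j l * T l =
      (1 / 2) * kropinaHess a b m y (EuclideanSpace.single j 1) T := by
  simp only [fundTensor_kropina hsymm hpos hf hy, ← kropinaHess_sum y _ T, Finset.mul_sum]
  exact Finset.sum_congr rfl fun l _ => by ring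

theorem exists_sharp (hpos : ∀ v, v ≠ 0 → 0 < a v v) (u : Coord n →L[ℝ] ℝ) :
    ∃ U : Coord n, ∀ w, a U w = u w := by
  let φ : Coord n →ₗ[ℝ] (Coord n →ₗ[ℝ] ℝ) :=
    (ContinuousLinearMap.coeLM ℝ).comp a.toLinearMap
  have hinj : Function.Injective φ := by
    rw [← LinearMap.ker_eq_bot, LinearMap.ker_eq_bot']
    intro v hv
    by_contra h
    have h1 : φ v v = 0 := by rw [hv]; rfl
    exact (hpos v h).ne' h1
  have hsurj : Function.Surjective φ :=
    (LinearMap.injective_iff_surjective_of_finrank_eq_finrank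
      (Subspace.dual_finrank_eq (K := ℝ) (V := Coord n)).symm).1 hinj
  obtain ⟨U, hU⟩ := hsurj u.toLinearMap
  exact ⟨U, fun w => congrArg (fun ψ : Coord n →ₗ[ℝ] ℝ => ψ w) hU⟩

/-- A solution of a linear system whose matrix is the Hessian of an `m`-Kropina norm at the point
`bs + t e`, where `bs` is dual to `b` and `e` is a vector orthogonal to `bs` of the same length. -/
theorem kropinaHess_solution (hsymm : ∀ v w, a v w = a w v)
    (hm1 : m ≠ 1) {bs e U : Coord n} {u : Coord n →L[ℝ] ℝ} (hbs : ∀ w, a bs w = b w)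
    (hU : ∀ w, a U w = u w) {k : ℝ} (hk : 0 < k) (hb : b bs = k) (hbe : b e = 0) (hee : a e e = k)
    {t : ℝ} (ht : 1 - m * t ^ 2 ≠ 0) (w : Coord n) :
    kropinaHess a b m (bs + t • e) w
      ((1 / (1 - m)) • ((m * ((u bs * (1 - t ^ 2) + 2 * u e * t) / (1 - m * t ^ 2))) •
        ((1 - t ^ 2) • bs + (2 * t) • e) + (k * (1 + t ^ 2)) • U -
        (2 * m * (u bs + t * u e)) • (bs + t • e))) =
      2 * kropinaSq a b m (bs + t • e) * u w := by
  have hm : 1 - m ≠ 0 := sub_ne_zero.2 hm1.symm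
  have h1t : 1 + t ^ 2 ≠ 0 := by positivity
  have hbU : b U = u bs := by rw [← hbs, hsymm, hU]
  have heU : a e U = u e := by rw [hsymm, hU]
  have hwU : a w U = u w := by rw [hsymm, hU]
  have heb : a e bs = 0 := by rw [hsymm, hbs, hbe]
  have hwb : a w bs = b w := by rw [hsymm, hbs]
  have hwe : a w e = a e w := hsymm _ _
  simp only [kropinaHess, kropinaLogDeriv, map_add, map_smul, add_apply, smul_apply, smul_eq_mul,
    map_sub, hbs, hb, hbe, hee, hbU, heU, hwU, heb, hwb, hwe]
  -- Up to the factor `K`, the Hessian is a multiple of `a` plus products of the forms `a(y, ·)` and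
  -- `b`, so the solution is sought as a combination of `U`, `bs` and `y`. The vector `(1 - t²) bs +
  -- 2t e` is `1 + t²` times the mirror image of `bs` in the line through `y`. What remains is a
  -- rational identity in scalars, linear in `K`.
  generalize kropinaSq a b m (bs + t • e) = K
  have hA' : k + t * 0 + t * (0 + t * k) = k * (1 + t ^ 2) := by ring
  have hB : k + t * 0 = k := by ring
  rw [hA', hB]
  field_simp
  ring

end Fibre

end LocalFinsler

/-! ### Third derivatives of functions of one variable -/

/-- `f''' = g` on `I`. -/
def ThirdDerivOn (I : Set ℝ) (f g : ℝ → ℝ) : Prop :=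
  ∃ f₁ f₂ : ℝ → ℝ, ∀ t ∈ I, HasDerivAt f (f₁ t) t ∧ HasDerivAt f₁ (f₂ t) t ∧ HasDerivAt f₂ (g t) t

namespace ThirdDerivOn

variable {I : Set ℝ} {f g f' g' : ℝ → ℝ}

theorem unique (hI : IsOpen I) (h : ThirdDerivOn I f g) (h' : ThirdDerivOn I f' g')
    (hff : Set.EqOn f f' I) : Set.EqOn g g' I := by
  obtain ⟨f₁, f₂, hf⟩ := h
  obtain ⟨k₁, k₂, hk⟩ := h'
  have key : ∀ {a b a' b' : ℝ → ℝ}, Set.EqOn a b I → (∀ t ∈ I, HasDerivAt a (a' t) t) →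
      (∀ t ∈ I, HasDerivAt b (b' t) t) → Set.EqOn a' b' I := fun hab ha hb t ht =>
    (ha t ht).unique ((hb t ht).congr_of_eventuallyEq (hab.eventuallyEq_of_mem (hI.mem_nhds ht)))
  have h1 := key hff (fun t ht => (hf t ht).1) fun t ht => (hk t ht).1
  have h2 := key h1 (fun t ht => (hf t ht).2.1) fun t ht => (hk t ht).2.1
  exact key h2 (fun t ht => (hf t ht).2.2) fun t ht => (hk t ht).2.2

theorem sub (h : ThirdDerivOn I f g) (h' : ThirdDerivOn I f' g') :
    ThirdDerivOn I (fun t => f t - f' t) (fun t => g t - g' t) := by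
  obtain ⟨f₁, f₂, hf⟩ := h
  obtain ⟨k₁, k₂, hk⟩ := h'
  exact ⟨fun t => f₁ t - k₁ t, fun t => f₂ t - k₂ t, fun t ht =>
    ⟨(hf t ht).1.sub (hk t ht).1, (hf t ht).2.1.sub (hk t ht).2.1, (hf t ht).2.2.sub (hk t ht).2.2⟩⟩

theorem quadratic (q₀ q₁ q₂ : ℝ) :
    ThirdDerivOn I (fun t => q₀ + q₁ * t + q₂ * t ^ 2) fun _ => 0 := by
  refine ⟨fun t => q₁ + 2 * q₂ * t, fun _ => 2 * q₂, fun t _ => ⟨?_, ?_, hasDerivAt_const _ _⟩⟩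
  · exact ((((hasDerivAt_id' t).const_mul q₁).const_add q₀).add
      (((hasDerivAt_id' t).pow 2).const_mul q₂)).congr_deriv (by norm_num; ring)
  · exact (((hasDerivAt_id' t).const_mul (2 * q₂)).const_add q₁).congr_deriv (by ring)

theorem mul_quadratic {p p₁ p₂ p₃ : ℝ → ℝ} (q₀ q₁ q₂ r₀ r₁ r₂ : ℝ)
    (h : ∀ t ∈ I, HasDerivAt p (p₁ t) t ∧ HasDerivAt p₁ (p₂ t) t ∧ HasDerivAt p₂ (p₃ t) t) :
    ThirdDerivOn I
      (fun t => q₀ + q₁ * t + q₂ * t ^ 2 + p t * (r₀ + r₁ * t + r₂ * t ^ 2))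
      (fun t => p₃ t * (r₀ + r₁ * t + r₂ * t ^ 2) + 3 * p₂ t * (r₁ + 2 * r₂ * t) +
        6 * r₂ * p₁ t) := by
  have hq : ∀ q₀ q₁ q₂ t : ℝ, HasDerivAt (fun t : ℝ => q₀ + q₁ * t + q₂ * t ^ 2)
      (q₁ + 2 * q₂ * t) t := fun q₀ q₁ q₂ t =>
    ((((hasDerivAt_id' t).const_mul q₁).const_add q₀).add
      (((hasDerivAt_id' t).pow 2).const_mul q₂)).congr_deriv (by norm_num; ring)
  have hl : ∀ q₁ q₂ t : ℝ, HasDerivAt (fun t : ℝ => q₁ + 2 * q₂ * t) (2 * q₂) t := fun q₁ q₂ t =>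
    (((hasDerivAt_id' t).const_mul (2 * q₂)).const_add q₁).congr_deriv (by ring)
  refine ⟨fun t => (q₁ + 2 * q₂ * t) + (p₁ t * (r₀ + r₁ * t + r₂ * t ^ 2) +
      p t * (r₁ + 2 * r₂ * t)),
    fun t => 2 * q₂ + (p₂ t * (r₀ + r₁ * t + r₂ * t ^ 2) + 2 * (p₁ t * (r₁ + 2 * r₂ * t)) +
      p t * (2 * r₂)), fun t ht => ?_⟩
  obtain ⟨h0, h1, h2⟩ := h t ht
  refine ⟨(hq q₀ q₁ q₂ t).add (h0.mul (hq r₀ r₁ r₂ t)), ?_, ?_⟩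
  · exact ((hl q₁ q₂ t).add ((h1.mul (hq r₀ r₁ r₂ t)).add (h0.mul (hl r₁ r₂ t)))).congr_deriv
      (by ring)
  · exact ((((h2.mul (hq r₀ r₁ r₂ t)).add ((h1.mul (hl r₁ r₂ t)).const_mul 2)).add
      (h0.mul_const (2 * r₂))).const_add (2 * q₂)).congr_deriv (by ring)

/-- Integrates three times, subtracting the Taylor polynomial at `0` at each stage. It turns the
Douglas condition along a line into an explicit quadratic. -/
theorem exists_quadratic {δ : ℝ} (hδ : 0 < δ) (h : ThirdDerivOn (Set.Ioo (-δ) δ) f g)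
    (hg : ∀ t ∈ Set.Ioo (-δ) δ, g t = 0) :
    ∃ q₀ q₁ q₂ : ℝ, ∀ t ∈ Set.Ioo (-δ) δ, f t = q₀ + q₁ * t + q₂ * t ^ 2 := by
  obtain ⟨f₁, f₂, hf⟩ := h
  have h0 : (0 : ℝ) ∈ Set.Ioo (-δ) δ := ⟨by linarith, hδ⟩
  have key : ∀ {k : ℝ → ℝ}, (∀ t ∈ Set.Ioo (-δ) δ, HasDerivAt k 0 t) →
      ∀ t ∈ Set.Ioo (-δ) δ, k t = k 0 := fun {k} hk t ht =>
    isOpen_Ioo.is_const_of_deriv_eq_zero isPreconnected_Ioo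
      (fun s hs => (hk s hs).differentiableAt.differentiableWithinAt)
      (fun s hs => (hk s hs).deriv) ht h0
  have h2 := key fun t ht => ((hf t ht).2.2).congr_deriv (hg t ht)
  have h1 := key (k := fun t => f₁ t - f₂ 0 * t) fun t ht =>
    ((hf t ht).2.1.sub ((hasDerivAt_id' t).const_mul (f₂ 0))).congr_deriv (by rw [h2 t ht]; ring)
  have h3 := key (k := fun t => f t - (f₁ 0 * t + f₂ 0 / 2 * t ^ 2)) fun t ht =>
    ((hf t ht).1.sub (((hasDerivAt_id' t).const_mul (f₁ 0)).add
      (((hasDerivAt_id' t).pow 2).const_mul (f₂ 0 / 2)))).congr_deriv (by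
        have := h1 t ht
        norm_num at this ⊢
        linarith)
  refine ⟨f 0, f₁ 0, f₂ 0 / 2, fun t ht => ?_⟩
  have := h3 t ht
  norm_num at this
  linarith

end ThirdDerivOn

theorem coeff_eq_zero_of_eqOn_Ioo {δ : ℝ} (hδ : 0 < δ) {c₀ c₁ c₂ c₃ c₄ c₅ : ℝ}
    (h : ∀ t ∈ Set.Ioo (-δ) δ,
      c₀ + c₁ * t + c₂ * t ^ 2 + c₃ * t ^ 3 + c₄ * t ^ 4 + c₅ * t ^ 5 = 0) :
    c₀ = 0 ∧ c₁ = 0 ∧ c₂ = 0 ∧ c₃ = 0 ∧ c₄ = 0 ∧ c₅ = 0 := by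
  open Polynomial in
  let P : ℝ[X] := C c₀ + C c₁ * X + C c₂ * X ^ 2 + C c₃ * X ^ 3 + C c₄ * X ^ 4 + C c₅ * X ^ 5
  have hP : P = 0 := by
    refine Polynomial.eq_zero_of_infinite_isRoot P
      ((Set.Ioo_infinite (by linarith : -δ < δ)).mono ?_)
    intro t ht
    simpa [P] using h t ht
  have hc : ∀ i, P.coeff i = 0 := fun i => by rw [hP, Polynomial.coeff_zero]
  refine ⟨?_, ?_, ?_, ?_, ?_, ?_⟩
  · simpa [P, Polynomial.coeff_X, Polynomial.coeff_C] using hc 0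
  · simpa [P, Polynomial.coeff_X, Polynomial.coeff_C] using hc 1
  · simpa [P, Polynomial.coeff_X, Polynomial.coeff_C] using hc 2
  · simpa [P, Polynomial.coeff_X, Polynomial.coeff_C] using hc 3
  · simpa [P, Polynomial.coeff_X, Polynomial.coeff_C] using hc 4
  · simpa [P, Polynomial.coeff_X, Polynomial.coeff_C] using hc 5

namespace LocalFinsler

variable {n : ℕ}

/-! ### Fibre derivatives along a line -/

section Line

variable {h : Coord n → Coord n → ℝ} {O : Set (Coord n × Coord n)} {x : Coord n}

theorem fderiv_eq_sum_dY (x y e : Coord n) (h : Coord n → Coord n → ℝ) :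
    fderiv ℝ (fun w => h x w) y e = ∑ i, e i * dY i h x y := by
  rw [← sum_apply_single]
  exact Finset.sum_congr rfl fun i _ => mul_comm _ _

theorem hasDerivAt_line (hO : IsOpen O) (hh : ContDiffOn ℝ ∞ (Function.uncurry h) O)
    {p e : Coord n} {t : ℝ} (ht : (x, p + t • e) ∈ O) :
    HasDerivAt (fun t => h x (p + t • e)) (∑ i, e i * dY i h x (p + t • e)) t := by
  rw [← fderiv_eq_sum_dY]
  have h1 := (hasFDerivAt_slice_right hO hh ht).differentiableAt.hasFDerivAt
  have h2 : HasDerivAt (fun t : ℝ => p + t • e) e t := by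
    simpa using ((hasDerivAt_id t).smul_const e).const_add p
  exact h1.comp_hasDerivAt t h2

theorem thirdDerivOn_line (hO : IsOpen O) (hh : ContDiffOn ℝ ∞ (Function.uncurry h) O)
    {p e : Coord n} {I : Set ℝ} (hI : ∀ t ∈ I, (x, p + t • e) ∈ O) :
    ThirdDerivOn I (fun t => h x (p + t • e)) (fun t => ∑ k, e k * ∑ j, e j * ∑ i, e i *
      dY i (dY j (dY k h)) x (p + t • e)) := by
  refine ⟨fun t => ∑ k, e k * dY k h x (p + t • e),
    fun t => ∑ k, e k * ∑ j, e j * dY j (dY k h) x (p + t • e), fun t ht => ⟨?_, ?_, ?_⟩⟩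
  · exact hasDerivAt_line hO hh (hI t ht)
  · exact HasDerivAt.fun_sum fun k _ =>
      (hasDerivAt_line hO (contDiffOn_dY hO hh k) (hI t ht)).const_mul _
  · exact HasDerivAt.fun_sum fun k _ => HasDerivAt.const_mul _ (HasDerivAt.fun_sum fun j _ =>
      (hasDerivAt_line hO (contDiffOn_dY hO (contDiffOn_dY hO hh k) j) (hI t ht)).const_mul _)

end Line

/-! ### The rational function that controls the spray difference -/

/-- The function `(α (1 - t²) + 2 β t) / (1 - m t²)`. -/
def lineRatio (m α β t : ℝ) : ℝ := (α * (1 - t ^ 2) + 2 * β * t) / (1 - m * t ^ 2)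

section LineRatio

variable {m α β δ : ℝ}

theorem exists_radius (m : ℝ) : ∃ δ : ℝ, 0 < δ ∧ ∀ t ∈ Set.Ioo (-δ) δ, 1 - m * t ^ 2 ≠ 0 := by
  have hc : ContinuousAt (fun t : ℝ => 1 - m * t ^ 2) 0 := by fun_prop
  have := hc.eventually_ne (y := 0) (by simp)
  obtain ⟨δ, hδ, h⟩ := Metric.eventually_nhds_iff.1 this
  exact ⟨δ, hδ, fun t ht => h (by simpa [abs_lt] using ht)⟩

theorem exists_deriv_lineRatio (hm : ∀ t ∈ Set.Ioo (-δ) δ, 1 - m * t ^ 2 ≠ 0) :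
    ∃ p₁ p₂ p₃ : ℝ → ℝ, ∀ t ∈ Set.Ioo (-δ) δ, HasDerivAt (lineRatio m α β) (p₁ t) t ∧
      HasDerivAt p₁ (p₂ t) t ∧ HasDerivAt p₂ (p₃ t) t := by
  have h0 : ContDiffOn ℝ ∞ (lineRatio m α β) (Set.Ioo (-δ) δ) := by
    refine ContDiffOn.div ?_ ?_ hm <;> exact ContDiff.contDiffOn (by fun_prop)
  have key : ∀ p : ℝ → ℝ, ContDiffOn ℝ ∞ p (Set.Ioo (-δ) δ) →
      ContDiffOn ℝ ∞ (deriv p) (Set.Ioo (-δ) δ) ∧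
      ∀ t ∈ Set.Ioo (-δ) δ, HasDerivAt p (deriv p t) t := fun p hp =>
    ⟨hp.deriv_of_isOpen isOpen_Ioo (by simp), fun t ht =>
      ((hp.contDiffAt (isOpen_Ioo.mem_nhds ht)).differentiableAt (by simp)).hasDerivAt⟩
  obtain ⟨h1, h1'⟩ := key _ h0
  obtain ⟨h2, h2'⟩ := key _ h1
  obtain ⟨-, h3'⟩ := key _ h2
  exact ⟨_, _, _, fun t ht => ⟨h1' t ht, h2' t ht, h3' t ht⟩⟩

/-- The assumed equation and `1 + t²` times the equation `(R (1 - m t²))''' = 0` have the same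
coefficients at `R'''` and `R''`. Their difference is `6 (m - 1) R' = 0`, and a constant `R` makes
`α (1 - t²) + 2 β t` proportional to `1 - m t²`. -/
theorem lineRatio_eq_zero_of_landsberg (hm1 : m ≠ 1) (hδ : 0 < δ)
    (hm : ∀ t ∈ Set.Ioo (-δ) δ, 1 - m * t ^ 2 ≠ 0) {p₁ p₂ p₃ : ℝ → ℝ}
    (hp : ∀ t ∈ Set.Ioo (-δ) δ, HasDerivAt (lineRatio m α β) (p₁ t) t ∧
      HasDerivAt p₁ (p₂ t) t ∧ HasDerivAt p₂ (p₃ t) t)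
    (h : ∀ t ∈ Set.Ioo (-δ) δ,
      (1 + m * t ^ 2) * (p₃ t * (1 - t ^ 2) - 6 * t * p₂ t - 6 * p₁ t) +
        2 * (1 - m) * t * (p₃ t * t + 3 * p₂ t) = 0) : α = 0 ∧ β = 0 := by
  have hm1' : m - 1 ≠ 0 := sub_ne_zero.2 hm1
  have hz : ∀ t ∈ Set.Ioo (-δ) δ, lineRatio m α β t * (1 - m * t ^ 2) =
      α * (1 - t ^ 2) + 2 * β * t := fun t ht => div_mul_cancel₀ _ (hm t ht)
  have h3 : ∀ t ∈ Set.Ioo (-δ) δ,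
      p₃ t * (1 - m * t ^ 2) - 6 * m * t * p₂ t - 6 * m * p₁ t = 0 := by
    intro t ht
    have := (ThirdDerivOn.mul_quadratic 0 0 0 1 0 (-m) hp).unique isOpen_Ioo
      (ThirdDerivOn.quadratic α (2 * β) (-α)) (fun s hs => by
        have := hz s hs
        simp only
        linarith) ht
    simp only at this
    linarith
  have h1 : ∀ t ∈ Set.Ioo (-δ) δ, p₁ t = 0 := by
    intro t ht
    have : 6 * (m - 1) * p₁ t = 0 := by
      linear_combination h t ht - (1 + t ^ 2) * h3 t ht
    simpa [hm1'] using this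
  have h4 : ∀ t ∈ Set.Ioo (-δ) δ, -2 * m * t * (α * (1 - t ^ 2) + 2 * β * t) =
      (-2 * α * t + 2 * β) * (1 - m * t ^ 2) := by
    intro t ht
    have ha : HasDerivAt (fun t => lineRatio m α β t * (1 - m * t ^ 2))
        (p₁ t * (1 - m * t ^ 2) + lineRatio m α β t * (-(m * (2 * t)))) t :=
      (hp t ht).1.mul (((((hasDerivAt_id' t).pow 2).const_mul m).const_sub 1).congr_deriv
        (by norm_num))
    have hb : HasDerivAt (fun t => α * (1 - t ^ 2) + 2 * β * t) (α * (-(2 * t)) + 2 * β) t :=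
      (((((hasDerivAt_id' t).pow 2).const_sub 1).const_mul α).add
        ((hasDerivAt_id' t).const_mul (2 * β))).congr_deriv (by norm_num)
    have he := ha.unique (hb.congr_of_eventuallyEq
      ((show Set.EqOn _ _ (Set.Ioo (-δ) δ) from hz).eventuallyEq_of_mem (isOpen_Ioo.mem_nhds ht)))
    rw [h1 t ht] at he
    linear_combination (1 - m * t ^ 2) * he + 2 * m * t * hz t ht
  have hβ : β = 0 := by
    have := h4 0 ⟨by linarith, hδ⟩
    linarith
  -- Any nonzero point of the interval would do: with `β = 0`, the relation `h4` reduces to `(m - 1)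
  -- t α = 0`.
  have ht : δ / 2 ∈ Set.Ioo (-δ) δ := ⟨by linarith, by linarith⟩
  have h5 := h4 _ ht
  rw [hβ] at h5
  have h6 : (m - 1) * (δ * α) = 0 := by linear_combination -h5
  refine ⟨?_, hβ⟩
  simpa [hm1', hδ.ne'] using h6

/-- The second relation minus `t` times the first eliminates the unknown `τ` and leaves `c R t (1 +
t²)` equal to a cubic. Clearing the denominator gives a polynomial identity of degree five. For `m =
-1` the factor `1 + t²` would cancel the denominator `1 - m t²`, and nothing would follow. -/
theorem lineRatio_eq_zero_of_douglas (hm1 : m ≠ 1) (hm1' : m ≠ -1) (hδ : 0 < δ)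
    (hm : ∀ t ∈ Set.Ioo (-δ) δ, 1 - m * t ^ 2 ≠ 0) {c : ℝ} (hc : c ≠ 0) {τ : ℝ → ℝ}
    {q₀ q₁ q₂ r₀ r₁ r₂ : ℝ}
    (h1 : ∀ t ∈ Set.Ioo (-δ) δ, c * lineRatio m α β t * (1 - t ^ 2) + τ t =
      q₀ + q₁ * t + q₂ * t ^ 2)
    (h2 : ∀ t ∈ Set.Ioo (-δ) δ, c * lineRatio m α β t * (2 * t) + τ t * t =
      r₀ + r₁ * t + r₂ * t ^ 2) : α = 0 ∧ β = 0 := by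
  have key : ∀ t ∈ Set.Ioo (-δ) δ,
      (-r₀) + (c * α - (r₁ - q₀)) * t + (c * 2 * β - (r₂ - q₁) + m * r₀) * t ^ 2 +
        (q₂ + m * (r₁ - q₀)) * t ^ 3 + (c * 2 * β + m * (r₂ - q₁)) * t ^ 4 +
        (-(c * α) - m * q₂) * t ^ 5 = 0 := by
    intro t ht
    have hz : lineRatio m α β t * (1 - m * t ^ 2) = α * (1 - t ^ 2) + 2 * β * t :=
      div_mul_cancel₀ _ (hm t ht)
    linear_combination (1 - m * t ^ 2) * (h2 t ht - t * h1 t ht) - c * t * (1 + t ^ 2) * hz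
  obtain ⟨e0, e1, e2, e3, e4, e5⟩ := coeff_eq_zero_of_eqOn_Ioo hδ key
  have hp : m + 1 ≠ 0 := fun h => hm1' (by linarith)
  have hn : m - 1 ≠ 0 := sub_ne_zero.2 hm1
  -- These combinations of the even and of the odd coefficients reduce the identity modulo `1 - m
  -- t²`, so all the unknown quadratic coefficients drop out.
  have hβ : (m + 1) * (c * β) = 0 := by linear_combination (e4 + m * e2 + m ^ 2 * e0) / 2
  have hα : (m - 1) * ((m + 1) * (c * α)) = 0 := by
    linear_combination e5 + m * e3 + m ^ 2 * e1
  simp only [mul_eq_zero, hp, hn, hc, false_or] at hα hβ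
  exact ⟨hα, hβ⟩

end LineRatio

/-! ### Rigidity of conformal Landsberg and Douglas `m`-Kropina metrics -/

section Rigidity

variable {a : Coord n →L[ℝ] Coord n →L[ℝ] ℝ} {b : Coord n →L[ℝ] ℝ} {m : ℝ}
  {f f' : Coord n → Coord n → ℝ} {O : Set (Coord n × Coord n)} {u : Coord n → ℝ} {x : Coord n}
  {bs e U : Coord n} {k δ : ℝ}

/-- `kropinaHess_solution` solves the linear system for every right-hand side, so the matrix is
surjective. This places the line in the domain where the Landsberg and Douglas hypotheses apply. -/
theorem isUnit_fundTensor_line (hsymm : ∀ v w, a v w = a w v)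
    (hpos : ∀ v, v ≠ 0 → 0 < a v v) (hm1 : m ≠ 1)
    (hfx : ∀ y, 0 < b y → f x y = Real.sqrt (a y y) ^ (1 - m) * b y ^ m)
    (hbs : ∀ w, a bs w = b w) (hk : 0 < k) (hb : b bs = k) (hbe : b e = 0) (hee : a e e = k)
    {t : ℝ} (ht : 1 - m * t ^ 2 ≠ 0) : IsUnit (fundTensor f x (bs + t • e)).det := by
  have hy : 0 < b (bs + t • e) := by simpa [hb, hbe] using hk
  rw [← Matrix.isUnit_iff_isUnit_det, ← Matrix.mulVec_surjective_iff_isUnit]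
  intro v
  let w : Coord n →L[ℝ] ℝ := ∑ l, v l • (EuclideanSpace.proj l : Coord n →L[ℝ] ℝ)
  have hw : ∀ j, w (EuclideanSpace.single j 1) = v j := fun j => by
    simp [w, PiLp.single_apply]
  obtain ⟨W, hW⟩ := exists_sharp hpos w
  have hK := (kropinaSq_pos (m := m) hpos hy).ne'
  have hs := fun j => kropinaHess_solution hsymm hm1 hbs hW hk hb hbe hee ht
    (EuclideanSpace.single j 1)
  set T := (1 / (1 - m)) • ((m * ((w bs * (1 - t ^ 2) + 2 * w e * t) / (1 - m * t ^ 2))) •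
        ((1 - t ^ 2) • bs + (2 * t) • e) + (k * (1 + t ^ 2)) • W -
        (2 * m * (w bs + t * w e)) • (bs + t • e))
  refine ⟨fun l => (kropinaSq a b m (bs + t • e))⁻¹ * T l, funext fun j => ?_⟩
  have h1 := sum_fundTensor_kropina hsymm hpos hfx hy j T
  rw [hs, hw] at h1
  calc _ = (kropinaSq a b m (bs + t • e))⁻¹ * ∑ l, fundTensor f x (bs + t • e) j l * T l := by
        rw [Finset.mul_sum, Matrix.mulVec, dotProduct]
        exact Finset.sum_congr rfl fun l _ => by ring
    _ = v j := by rw [h1]; field_simp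

/-- The difference of the geodesic coefficients of conformal `m`-Kropina metrics on a line. -/
theorem spray_line (hO : IsOpen O) (hf : ContDiffOn ℝ ∞ (Function.uncurry f) O)
    (hff : ∀ p ∈ O, f' p.1 p.2 = Real.exp (u p.1) * f p.1 p.2)
    (hx : ∀ y, 0 < b y → (x, y) ∈ O) (hu : DifferentiableAt ℝ u x)
    (hsymm : ∀ v w, a v w = a w v) (hpos : ∀ v, v ≠ 0 → 0 < a v v) (hm1 : m ≠ 1)
    (hfx : ∀ y, 0 < b y → f x y = Real.sqrt (a y y) ^ (1 - m) * b y ^ m)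
    (hbs : ∀ w, a bs w = b w) (hU : ∀ w, a U w = fderiv ℝ u x w)
    (hk : 0 < k) (hb : b bs = k) (hbe : b e = 0) (hee : a e e = k)
    {t : ℝ} (ht : 1 - m * t ^ 2 ≠ 0) (l : Fin n) :
    spray f' l x (bs + t • e) - spray f l x (bs + t • e) =
      (fderiv ℝ u x bs + t * fderiv ℝ u x e) * (1 + m / (1 - m)) * (bs l + t * e l) -
      k / (2 * (1 - m)) * (1 + t ^ 2) * U l -
      m / (2 * (1 - m)) * lineRatio m (fderiv ℝ u x bs) (fderiv ℝ u x e) t *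
        ((1 - t ^ 2) * bs l + 2 * t * e l) := by
  have hm : 1 - m ≠ 0 := sub_ne_zero.2 hm1.symm
  have hy : 0 < b (bs + t • e) := by simpa [hb, hbe] using hk
  have hs := fun j => kropinaHess_solution hsymm hm1 hbs hU hk hb hbe hee ht
    (EuclideanSpace.single j 1)
  set T := (1 / (1 - m)) • ((m * ((fderiv ℝ u x bs * (1 - t ^ 2) + 2 * fderiv ℝ u x e * t) /
      (1 - m * t ^ 2))) • ((1 - t ^ 2) • bs + (2 * t) • e) + (k * (1 + t ^ 2)) • U -
        (2 * m * (fderiv ℝ u x bs + t * fderiv ℝ u x e)) • (bs + t • e)) with hT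
  -- Here `T = F² g⁻¹ du`, and `g y = ½ d(F²)` by `kropinaHess_self`. The spray difference is
  -- therefore `du(y) y - ½ T`.
  have hS := spray_conformal hO hf hff (hx _ hy) hu
    (isUnit_fundTensor_line hsymm hpos hm1 hfx hbs hk hb hbe hee ht)
    (fun l => (fderiv ℝ u x (bs + t • e) • (bs + t • e) - (1 / 2 : ℝ) • T) l) (fun j => by
      have h1 := sum_fundTensor_kropina hsymm hpos hfx hy j
        (fderiv ℝ u x (bs + t • e) • (bs + t • e) - (1 / 2 : ℝ) • T)
      obtain ⟨φ, hφ⟩ := exists_kropinaHess_eq (a := a) (b := b) (m := m) (bs + t • e)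
        (EuclideanSpace.single j 1)
      have hs' := hs j
      have hself := kropinaHess_self (m := m) hsymm hpos hy (EuclideanSpace.single j 1)
      rw [hφ] at h1 hs' hself
      have hsq : f x (bs + t • e) ^ 2 = kropinaSq a b m (bs + t • e) :=
        (eventually_sq_eq hpos hfx hy).eq_of_nhds
      rw [h1, dY_sq_kropina hsymm hpos hfx hy, hsq, map_sub, map_smul, map_smul, hself, hs',
        smul_eq_mul, smul_eq_mul]
      ring) l
  rw [hS, hT]
  simp only [lineRatio, map_add, map_smul, PiLp.add_apply, PiLp.sub_apply, PiLp.smul_apply,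
    smul_eq_mul]
  field_simp
  ring

end Rigidity

section Rigidity

variable {a : Coord n →L[ℝ] Coord n →L[ℝ] ℝ} {b : Coord n →L[ℝ] ℝ} {m : ℝ}
  {f f' : Coord n → Coord n → ℝ} {O : Set (Coord n × Coord n)} {u : Coord n → ℝ} {x : Coord n}
  {bs e U : Coord n} {k δ : ℝ}

theorem exists_ne_zero_of_two_le (hn : 2 ≤ n) (b : Coord n →L[ℝ] ℝ) : ∃ e, e ≠ 0 ∧ b e = 0 := by
  by_contra! h
  have hinj : Function.Injective b.toLinearMap := by
    rw [← LinearMap.ker_eq_bot, LinearMap.ker_eq_bot']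
    intro v hv
    by_contra h0
    exact h v h0 hv
  have := LinearMap.finrank_le_finrank_of_injective hinj
  simp at this
  omega

/-- Every nonzero vector of `ker b` can be rescaled to the required length, and `bs` together with
`ker b` spans. Dimension at least two provides some admissible `e`, without which nothing would be
known about `w bs`. -/
theorem eq_zero_of_forall_orthogonal (hn : 2 ≤ n) (hpos : ∀ v, v ≠ 0 → 0 < a v v)
    (hk : 0 < k) (hb : b bs = k) (w : Coord n →L[ℝ] ℝ)
    (h : ∀ e, b e = 0 → a e e = k → w bs = 0 ∧ w e = 0) : w = 0 := by
  have h1 : ∀ v, v ≠ 0 → b v = 0 → w bs = 0 ∧ w v = 0 := by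
    intro v hv hbv
    have hp := hpos v hv
    have hs : Real.sqrt (k / a v v) ≠ 0 := by positivity
    obtain ⟨h2, h3⟩ := h (Real.sqrt (k / a v v) • v) (by simp [hbv]) (by
      simp only [map_smul, smul_apply, smul_eq_mul, ← mul_assoc]
      rw [Real.mul_self_sqrt (by positivity)]
      field_simp)
    refine ⟨h2, ?_⟩
    simpa [hs] using h3
  obtain ⟨e, he, hbe⟩ := exists_ne_zero_of_two_le hn b
  have hwb := (h1 e he hbe).1
  ext v
  have hv : v = (b v / k) • bs + (v - (b v / k) • bs) := by abel
  rw [hv, map_add, map_smul, hwb]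
  by_cases h0 : v - (b v / k) • bs = 0
  · simp [h0]
  · rw [(h1 _ h0 (by simp [hb, hk.ne'])).2]
    simp

theorem sum_landsbergTensor (f : Coord n → Coord n → ℝ) (x y e : Coord n) :
    ∑ k, e k * ∑ j, e j * ∑ i, e i * landsbergTensor f i j k x y =
      -(1 / 2 : ℝ) * ∑ l, f x y * dY l f x y *
        ∑ k, e k * ∑ j, e j * ∑ i, e i * dY i (dY j (dY k (spray f l))) x y := by
  simp only [landsbergTensor, Finset.mul_sum]
  conv_rhs => rw [Finset.sum_comm]
  refine Finset.sum_congr rfl fun k _ => ?_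
  conv_rhs => rw [Finset.sum_comm]
  refine Finset.sum_congr rfl fun j _ => ?_
  conv_rhs => rw [Finset.sum_comm]
  refine Finset.sum_congr rfl fun i _ => Finset.sum_congr rfl fun l _ => ?_
  ring

theorem regularSet_conformal (hO : IsOpen O)
    (hff : ∀ p ∈ O, f' p.1 p.2 = Real.exp (u p.1) * f p.1 p.2) {p : Coord n × Coord n}
    (hp : p ∈ regularSet f O) : p ∈ regularSet f' O :=
  ⟨hp.1, isUnit_fundTensor_conformal hO hff hp.1 hp.2⟩

/-- The third derivatives of the geodesic coefficients of conformal Landsberg metrics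
on a line. -/
theorem sum_third_spray_of_landsberg (hO : IsOpen O)
    (hf : ContDiffOn ℝ ∞ (Function.uncurry f) O)
    (hff : ∀ p ∈ O, f' p.1 p.2 = Real.exp (u p.1) * f p.1 p.2) {y : Coord n} (hy : (x, y) ∈ O)
    (hL : ∀ i j k, landsbergTensor f i j k x y = 0)
    (hL' : ∀ i j k, landsbergTensor f' i j k x y = 0) (e : Coord n) :
    ∑ l, dY l (fun x y => f x y ^ 2) x y *
      ((∑ k, e k * ∑ j, e j * ∑ i, e i * dY i (dY j (dY k (spray f' l))) x y) -
        ∑ k, e k * ∑ j, e j * ∑ i, e i * dY i (dY j (dY k (spray f l))) x y) = 0 := by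
  have h1 := sum_landsbergTensor f x y e
  have h2 := sum_landsbergTensor f' x y e
  simp only [hL, hL', mul_zero, Finset.sum_const_zero] at h1 h2
  have h3 : ∀ l, f' x y * dY l f' x y = Real.exp (u x) ^ 2 * (f x y * dY l f x y) := by
    intro l
    rw [hff _ hy, dY_congr hO (c := fun x => Real.exp (u x)) hff l hy]
    ring
  have h4 : ∀ l, dY l (fun x y => f x y ^ 2) x y = 2 * (f x y * dY l f x y) := by
    intro l
    have := (hasFDerivAt_slice_right hO hf hy).differentiableAt.hasFDerivAt.pow 2
    simp only [dY]
    rw [this.fderiv]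
    simp
    ring
  simp only [h3] at h2
  -- Both Landsberg tensors contract with the same covector `F F_{yˡ}` up to the positive factor
  -- `exp(u)²`, so the two vanishing conditions can be subtracted.
  simp only [h4, mul_sub, Finset.sum_sub_distrib]
  have h5 : ∀ g : Fin n → ℝ, ∑ l, 2 * (f x y * dY l f x y) * g l =
      2 * ∑ l, f x y * dY l f x y * g l := fun g => by
    rw [Finset.mul_sum]
    exact Finset.sum_congr rfl fun l _ => by ring
  have h6 : ∀ g : Fin n → ℝ, ∑ l, Real.exp (u x) ^ 2 * (f x y * dY l f x y) * g l =
      Real.exp (u x) ^ 2 * ∑ l, f x y * dY l f x y * g l := fun g => by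
    rw [Finset.mul_sum]
    exact Finset.sum_congr rfl fun l _ => by ring
  have he : Real.exp (u x) ^ 2 ≠ 0 := pow_ne_zero _ (Real.exp_ne_zero _)
  rw [h6] at h2
  rw [h5, h5]
  have h7 := (mul_eq_zero.1 ((mul_eq_zero.1 h2.symm).resolve_left (by norm_num))).resolve_left he
  have h8 := (mul_eq_zero.1 h1.symm).resolve_left (by norm_num)
  rw [h7, h8]
  simp

/-- Conformal `m`-Kropina metrics that are both Landsberg metrics are homothetic. -/
theorem fderiv_eq_zero_of_landsberg (hn : 2 ≤ n) (hO : IsOpen O)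
    (hf : ContDiffOn ℝ ∞ (Function.uncurry f) O) (hf' : ContDiffOn ℝ ∞ (Function.uncurry f') O)
    (hff : ∀ p ∈ O, f' p.1 p.2 = Real.exp (u p.1) * f p.1 p.2)
    (hx : ∀ y, 0 < b y → (x, y) ∈ O) (hu : DifferentiableAt ℝ u x)
    (hsymm : ∀ v w, a v w = a w v) (hpos : ∀ v, v ≠ 0 → 0 < a v v) (hb0 : b ≠ 0)
    (hm0 : m ≠ 0) (hm1 : m ≠ 1)
    (hfx : ∀ y, 0 < b y → f x y = Real.sqrt (a y y) ^ (1 - m) * b y ^ m)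
    (hL : ∀ y, (x, y) ∈ regularSet f O → ∀ i j k, landsbergTensor f i j k x y = 0)
    (hL' : ∀ y, (x, y) ∈ regularSet f' O → ∀ i j k, landsbergTensor f' i j k x y = 0) :
    fderiv ℝ u x = 0 := by
  have hm : 1 - m ≠ 0 := sub_ne_zero.2 hm1.symm
  obtain ⟨bs, hbs⟩ := exists_sharp hpos b
  obtain ⟨U, hU⟩ := exists_sharp hpos (fderiv ℝ u x)
  have hk : 0 < b bs := by
    rw [← hbs]
    refine hpos bs ?_
    rintro rfl
    exact hb0 (by ext w; rw [← hbs w]; simp)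
  obtain ⟨δ, hδ, hδm⟩ := exists_radius m
  refine eq_zero_of_forall_orthogonal (a := a) hn hpos hk rfl _ fun e hbe hee => ?_
  obtain ⟨p₁, p₂, p₃, hp⟩ := exists_deriv_lineRatio (α := fderiv ℝ u x bs)
    (β := fderiv ℝ u x e) hδm
  have hy : ∀ t : ℝ, 0 < b (bs + t • e) := fun t => by simpa [hbe] using hk
  have hreg : ∀ t ∈ Set.Ioo (-δ) δ, (x, bs + t • e) ∈ regularSet f O := fun t ht =>
    ⟨hx _ (hy t), isUnit_fundTensor_line hsymm hpos hm1 hfx hbs hk rfl hbe hee (hδm t ht)⟩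
  have hreg' : ∀ t ∈ Set.Ioo (-δ) δ, (x, bs + t • e) ∈ regularSet f' O := fun t ht =>
    regularSet_conformal hO hff (hreg t ht)
  have heb : a e bs = 0 := by rw [hsymm, hbs, hbe]
  refine lineRatio_eq_zero_of_landsberg hm1 hδ hδm hp fun t ht => ?_
  have hsum := sum_third_spray_of_landsberg hO hf hff (hx _ (hy t)) (hL _ (hreg t ht))
    (hL' _ (hreg' t ht)) e
  set c := m / (2 * (1 - m)) with hc
  have hc0 : c ≠ 0 := div_ne_zero hm0 (mul_ne_zero two_ne_zero hm)
  have h3 : ∀ l, (∑ k, e k * ∑ j, e j * ∑ i, e i *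
        dY i (dY j (dY k (spray f' l))) x (bs + t • e)) -
      (∑ k, e k * ∑ j, e j * ∑ i, e i * dY i (dY j (dY k (spray f l))) x (bs + t • e)) =
      -c * (p₃ t * (1 - t ^ 2) - 6 * t * p₂ t - 6 * p₁ t) * bs l -
        2 * c * (p₃ t * t + 3 * p₂ t) * e l := by
    intro l
    -- All terms of the spray difference without `lineRatio` are quadratic in `t` and disappear. In
    -- particular `U` drops out, leaving only `bs` and `e` components.
    have ha := (thirdDerivOn_line (isOpen_regularSet hO hf') (contDiffOn_spray hO hf' l) hreg').sub
      (thirdDerivOn_line (isOpen_regularSet hO hf) (contDiffOn_spray hO hf l) hreg)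
    have hq := ThirdDerivOn.mul_quadratic
      (fderiv ℝ u x bs * (1 + m / (1 - m)) * bs l - b bs / (2 * (1 - m)) * U l)
      ((1 + m / (1 - m)) * (fderiv ℝ u x bs * e l + fderiv ℝ u x e * bs l))
      ((1 + m / (1 - m)) * fderiv ℝ u x e * e l - b bs / (2 * (1 - m)) * U l)
      (-c * bs l) (-c * (2 * e l)) (c * bs l) hp
    have := ha.unique isOpen_Ioo hq (fun s hs => by
      simp only
      rw [spray_line hO hf hff hx hu hsymm hpos hm1 hfx hbs hU hk rfl hbe hee (hδm s hs)]
      ring) ht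
    simp only at this
    rw [this]
    ring
  simp only [h3, dY_sq_kropina hsymm hpos hfx (hy t)] at hsum
  have hK := (kropinaSq_pos (m := m) hpos (hy t)).ne'
  have hφ : ∃ φ : Coord n →L[ℝ] ℝ, ∀ w, kropinaLogDeriv a b m (bs + t • e) w = φ w := by
    refine ⟨(2 * (1 - m) / a (bs + t • e) (bs + t • e)) • a (bs + t • e) +
      (2 * m / b (bs + t • e)) • b, fun w => ?_⟩
    simp only [kropinaLogDeriv, add_apply, smul_apply, smul_eq_mul]
    ring
  obtain ⟨φ, hφ⟩ := hφ
  have hφb := hφ bs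
  have hφe := hφ e
  have hsum' : kropinaSq a b m (bs + t • e) *
      (-c * (p₃ t * (1 - t ^ 2) - 6 * t * p₂ t - 6 * p₁ t) * φ bs -
        2 * c * (p₃ t * t + 3 * p₂ t) * φ e) = 0 := by
    rw [← hsum, ← sum_apply_single φ bs, ← sum_apply_single φ e, Finset.mul_sum, Finset.mul_sum,
      ← Finset.sum_sub_distrib, Finset.mul_sum]
    exact Finset.sum_congr rfl fun l _ => by rw [hφ]; ring
  have h1t : 1 + t ^ 2 ≠ 0 := by positivity
  simp only [kropinaLogDeriv, map_add, map_smul, add_apply, smul_apply, smul_eq_mul, hbs, hbe,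
    hee, heb, mul_zero, add_zero, zero_add] at hφb hφe
  have hA : b bs + t * (t * b bs) = b bs * (1 + t ^ 2) := by ring
  rw [hA] at hφb hφe
  have hk' := hk.ne'
  -- The values of `d log F²` on `bs` and `e` supply the two weights in the differential equation
  -- for `lineRatio`.
  have e1 : φ bs * (1 + t ^ 2) = 2 * (1 + m * t ^ 2) := by
    rw [← hφb]
    field_simp
    ring
  have e2 : φ e * (1 + t ^ 2) = 2 * (1 - m) * t := by
    rw [← hφe]
    field_simp
    ring
  have hfin := (mul_eq_zero.1 hsum').resolve_left hK
  have : (-2 * c) * ((1 + m * t ^ 2) * (p₃ t * (1 - t ^ 2) - 6 * t * p₂ t - 6 * p₁ t) +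
        2 * (1 - m) * t * (p₃ t * t + 3 * p₂ t)) = 0 := by
    linear_combination (1 + t ^ 2) * hfin +
      c * (p₃ t * (1 - t ^ 2) - 6 * t * p₂ t - 6 * p₁ t) * e1 +
      2 * c * (p₃ t * t + 3 * p₂ t) * e2
  exact (mul_eq_zero.1 this).resolve_left (mul_ne_zero (by norm_num) hc0)

theorem contDiffOn_sprayTrace (hO : IsOpen O) (hf : ContDiffOn ℝ ∞ (Function.uncurry f) O)
    (i : Fin n) : ContDiffOn ℝ ∞ (Function.uncurry fun x y =>
      spray f i x y - (1 / ((n : ℝ) + 1)) * (∑ r, dY r (spray f r) x y) * y i)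
      (regularSet f O) := by
  refine (contDiffOn_spray hO hf i).sub (ContDiffOn.mul (contDiffOn_const.mul
    (ContDiffOn.sum fun r _ => contDiffOn_dY (isOpen_regularSet hO hf)
      (contDiffOn_spray hO hf r) r)) ?_)
  exact ((EuclideanSpace.proj i : Coord n →L[ℝ] ℝ).contDiff.comp contDiff_snd).contDiffOn

/-- Conformal `m`-Kropina metrics that are both Douglas metrics are homothetic if `m ≠ -1`. -/
theorem fderiv_eq_zero_of_douglas (hn : 2 ≤ n) (hO : IsOpen O)
    (hf : ContDiffOn ℝ ∞ (Function.uncurry f) O) (hf' : ContDiffOn ℝ ∞ (Function.uncurry f') O)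
    (hff : ∀ p ∈ O, f' p.1 p.2 = Real.exp (u p.1) * f p.1 p.2)
    (hx : ∀ y, 0 < b y → (x, y) ∈ O) (hu : DifferentiableAt ℝ u x)
    (hsymm : ∀ v w, a v w = a w v) (hpos : ∀ v, v ≠ 0 → 0 < a v v) (hb0 : b ≠ 0)
    (hm0 : m ≠ 0) (hm1 : m ≠ 1) (hm1' : m ≠ -1)
    (hfx : ∀ y, 0 < b y → f x y = Real.sqrt (a y y) ^ (1 - m) * b y ^ m)
    (hD : ∀ y, (x, y) ∈ regularSet f O → ∀ i j k l, douglasTensor f i j k l x y = 0)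
    (hD' : ∀ y, (x, y) ∈ regularSet f' O → ∀ i j k l, douglasTensor f' i j k l x y = 0) :
    fderiv ℝ u x = 0 := by
  have hm : 1 - m ≠ 0 := sub_ne_zero.2 hm1.symm
  obtain ⟨bs, hbs⟩ := exists_sharp hpos b
  obtain ⟨U, hU⟩ := exists_sharp hpos (fderiv ℝ u x)
  have hk : 0 < b bs := by
    rw [← hbs]
    refine hpos bs ?_
    rintro rfl
    exact hb0 (by ext w; rw [← hbs w]; simp)
  obtain ⟨δ, hδ, hδm⟩ := exists_radius m
  refine eq_zero_of_forall_orthogonal (a := a) hn hpos hk rfl _ fun e hbe hee => ?_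
  have hy : ∀ t : ℝ, 0 < b (bs + t • e) := fun t => by simpa [hbe] using hk
  have hreg : ∀ t ∈ Set.Ioo (-δ) δ, (x, bs + t • e) ∈ regularSet f O := fun t ht =>
    ⟨hx _ (hy t), isUnit_fundTensor_line hsymm hpos hm1 hfx hbs hk rfl hbe hee (hδm t ht)⟩
  have hreg' : ∀ t ∈ Set.Ioo (-δ) δ, (x, bs + t • e) ∈ regularSet f' O := fun t ht =>
    regularSet_conformal hO hff (hreg t ht)
  have heb : a e bs = 0 := by rw [hsymm, hbs, hbe]
  set c := m / (2 * (1 - m)) with hc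
  have hc0 : c ≠ 0 := div_ne_zero hm0 (mul_ne_zero two_ne_zero hm)
  set α := fderiv ℝ u x bs with hα
  set β := fderiv ℝ u x e with hβ
  -- The trace terms contribute a multiple of `y`. The multiplier `τ` is never computed, since it is
  -- eliminated later.
  let τ : ℝ → ℝ := fun t => (1 / ((n : ℝ) + 1)) * ((∑ r, dY r (spray f' r) x (bs + t • e)) -
    ∑ r, dY r (spray f r) x (bs + t • e))
  have hquad : ∀ i, ∃ q₀ q₁ q₂ : ℝ, ∀ t ∈ Set.Ioo (-δ) δ,
      (α + t * β) * (1 + m / (1 - m)) * (bs i + t * e i) -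
        b bs / (2 * (1 - m)) * (1 + t ^ 2) * U i -
        c * lineRatio m α β t * ((1 - t ^ 2) * bs i + 2 * t * e i) - τ t * (bs i + t * e i) =
      q₀ + q₁ * t + q₂ * t ^ 2 := by
    intro i
    have ha := (thirdDerivOn_line (isOpen_regularSet hO hf') (contDiffOn_sprayTrace hO hf' i)
      hreg').sub
      (thirdDerivOn_line (isOpen_regularSet hO hf) (contDiffOn_sprayTrace hO hf i) hreg)
    obtain ⟨q₀, q₁, q₂, hq⟩ := ha.exists_quadratic hδ (fun t ht => by
      have h1 := hD _ (hreg t ht) i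
      have h2 := hD' _ (hreg' t ht) i
      simp only [douglasTensor] at h1 h2
      simp only [h1, h2, mul_zero, Finset.sum_const_zero, sub_zero])
    refine ⟨q₀, q₁, q₂, fun t ht => ?_⟩
    rw [← hq t ht, ← spray_line hO hf hff hx hu hsymm hpos hm1 hfx hbs hU hk rfl hbe hee
      (hδm t ht)]
    simp only [τ, PiLp.add_apply, PiLp.smul_apply, smul_eq_mul]
    ring
  choose q₀ q₁ q₂ hq using hquad
  have hlin : ∀ (φ : Coord n →L[ℝ] ℝ), ∀ t ∈ Set.Ioo (-δ) δ,
      (α + t * β) * (1 + m / (1 - m)) * (φ bs + t * φ e) -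
        b bs / (2 * (1 - m)) * (1 + t ^ 2) * φ U -
        c * lineRatio m α β t * ((1 - t ^ 2) * φ bs + 2 * t * φ e) - τ t * (φ bs + t * φ e) =
      (∑ i, φ (EuclideanSpace.single i 1) * q₀ i) +
        (∑ i, φ (EuclideanSpace.single i 1) * q₁ i) * t +
        (∑ i, φ (EuclideanSpace.single i 1) * q₂ i) * t ^ 2 := by
    intro φ t ht
    rw [← sum_apply_single φ bs, ← sum_apply_single φ e, ← sum_apply_single φ U]
    simp only [Finset.mul_sum, Finset.sum_mul, ← Finset.sum_add_distrib,
      ← Finset.sum_sub_distrib]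
    refine Finset.sum_congr rfl fun i _ => ?_
    linear_combination φ (EuclideanSpace.single i 1) * hq i t ht
  have hk' := hk.ne'
  have hbU : b U = α := by rw [← hbs, hsymm, hU]
  have heU : a e U = β := by rw [hsymm, hU]
  -- Applying the forms `b` and `a e` extracts the `bs` and `e` components, each scaled by `k = b
  -- bs`. The quadratics passed on below gather all the polynomial terms after division by `k`.
  have h1 := fun t ht => hlin b t ht
  have h2 := fun t ht => hlin (a e) t ht
  simp only [hbe, hbU] at h1
  simp only [heb, hee, heU] at h2
  generalize (∑ i, b (EuclideanSpace.single i 1) * q₀ i) = r₀ at h1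
  generalize (∑ i, b (EuclideanSpace.single i 1) * q₁ i) = r₁ at h1
  generalize (∑ i, b (EuclideanSpace.single i 1) * q₂ i) = r₂ at h1
  generalize (∑ i, a e (EuclideanSpace.single i 1) * q₀ i) = s₀ at h2
  generalize (∑ i, a e (EuclideanSpace.single i 1) * q₁ i) = s₁ at h2
  generalize (∑ i, a e (EuclideanSpace.single i 1) * q₂ i) = s₂ at h2
  generalize b bs = k at *
  refine lineRatio_eq_zero_of_douglas hm1 hm1' hδ hδm hc0 (τ := τ)
    (q₀ := α * (1 + m / (1 - m)) - α / (2 * (1 - m)) - r₀ / k)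
    (q₁ := β * (1 + m / (1 - m)) - r₁ / k) (q₂ := -α / (2 * (1 - m)) - r₂ / k)
    (r₀ := - β / (2 * (1 - m)) - s₀ / k)
    (r₁ := α * (1 + m / (1 - m)) - s₁ / k)
    (r₂ := β * (1 + m / (1 - m)) - β / (2 * (1 - m)) - s₂ / k) ?_ ?_
  · intro t ht
    refine mul_left_cancel₀ hk' ?_
    have := h1 t ht
    field_simp at this ⊢
    linear_combination -this
  · intro t ht
    refine mul_left_cancel₀ hk' ?_
    have := h2 t ht
    field_simp at this ⊢
    linear_combination -this

end Rigidity

end LocalFinsler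

/-! ### Smoothness of the metric along tangent maps -/

section Smoothness

variable {n : ℕ} {M : Type*} [TopologicalSpace M] [ChartedSpace (Coord n) M]
  [IsManifold 𝓘(ℝ, Coord n) ∞ M]
  {E : Type*} [NormedAddCommGroup E] [NormedSpace ℝ E]
  {N : Type*} [NormedAddCommGroup N] [NormedSpace ℝ N]

theorem contDiffAt_oneForm_apply {β : (p : M) → TangentSpace 𝓘(ℝ, Coord n) p →L[ℝ] ℝ}
    (hβ : IsSmoothOneForm β) {v : N → TangentBundle 𝓘(ℝ, Coord n) M} {z : N}
    (hv : ContMDiffAt 𝓘(ℝ, N) 𝓘(ℝ, Coord n).tangent ∞ v z) :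
    ContDiffAt ℝ ∞ (fun z => β (v z).1 (v z).2) z := by
  have hb : ContMDiffAt 𝓘(ℝ, N) 𝓘(ℝ, Coord n) ∞ (fun z => (v z).1) z :=
    ((Bundle.contMDiff_proj (TangentSpace 𝓘(ℝ, Coord n) (M := M))).contMDiffAt).comp z hv
  have h0 : ContMDiffAt 𝓘(ℝ, N) (𝓘(ℝ, Coord n).prod 𝓘(ℝ, Coord n →L[ℝ] ℝ)) ∞
      (fun z => Bundle.TotalSpace.mk' (Coord n →L[ℝ] ℝ)
        (E := fun p : M => TangentSpace 𝓘(ℝ, Coord n) p →L[ℝ] Bundle.Trivial M ℝ p)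
        (v z).1 (β (v z).1)) z :=
    (ContMDiff.contMDiffAt hβ).comp z hb
  have h1 : ContMDiffAt 𝓘(ℝ, N) (𝓘(ℝ, Coord n).prod 𝓘(ℝ, ℝ)) ∞
      (fun z => Bundle.TotalSpace.mk' ℝ (E := Bundle.Trivial M ℝ) (v z).1 (β (v z).1 (v z).2)) z :=
    ContMDiffAt.clm_bundle_apply (F₁ := Coord n) (F₂ := ℝ) (E₁ := TangentSpace 𝓘(ℝ, Coord n))
      (E₂ := Bundle.Trivial M ℝ) (b := fun z => (v z).1)
      (v := fun z => (v z).2) (ϕ := fun z => β (v z).1) h0 hv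
  rw [Bundle.contMDiffAt_totalSpace] at h1
  exact h1.2.contDiffAt

theorem contDiffAt_metric_apply (a : SmoothRiemannianMetric n M)
    {v : N → TangentBundle 𝓘(ℝ, Coord n) M} {z : N}
    (hv : ContMDiffAt 𝓘(ℝ, N) 𝓘(ℝ, Coord n).tangent ∞ v z) :
    ContDiffAt ℝ ∞ (fun z => a.inner (v z).1 (v z).2 (v z).2) z := by
  have hb : ContMDiffAt 𝓘(ℝ, N) 𝓘(ℝ, Coord n) ∞ (fun z => (v z).1) z :=
    ((Bundle.contMDiff_proj (TangentSpace 𝓘(ℝ, Coord n) (M := M))).contMDiffAt).comp z hv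
  have h0 : ContMDiffAt 𝓘(ℝ, N) (𝓘(ℝ, Coord n).prod 𝓘(ℝ, Coord n →L[ℝ] Coord n →L[ℝ] ℝ)) ∞
      (fun z => Bundle.TotalSpace.mk' (Coord n →L[ℝ] Coord n →L[ℝ] ℝ)
        (E := fun p : M => TangentSpace 𝓘(ℝ, Coord n) p →L[ℝ] TangentSpace 𝓘(ℝ, Coord n) p →L[ℝ]
          Bundle.Trivial M ℝ p) (v z).1 (a.inner (v z).1)) z :=
    a.contMDiff.contMDiffAt.comp z hb
  have h1 : ContMDiffAt 𝓘(ℝ, N) (𝓘(ℝ, Coord n).prod 𝓘(ℝ, ℝ)) ∞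
      (fun z => Bundle.TotalSpace.mk' ℝ (E := Bundle.Trivial M ℝ) (v z).1
        (a.inner (v z).1 (v z).2 (v z).2)) z :=
    ContMDiffAt.clm_bundle_apply₂ (F₁ := Coord n) (F₂ := Coord n) (F₃ := ℝ)
      (E₁ := TangentSpace 𝓘(ℝ, Coord n)) (E₂ := TangentSpace 𝓘(ℝ, Coord n))
      (E₃ := Bundle.Trivial M ℝ) (b := fun z => (v z).1) (v := fun z => (v z).2)
      (w := fun z => (v z).2) (ψ := fun z => a.inner (v z).1) h0 hv hv
  rw [Bundle.contMDiffAt_totalSpace] at h1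
  exact h1.2.contDiffAt

theorem contDiffAt_kropina (a : SmoothRiemannianMetric n M)
    {β : (p : M) → TangentSpace 𝓘(ℝ, Coord n) p →L[ℝ] ℝ} (hβ : IsSmoothOneForm β) (m : ℝ)
    {v : N → TangentBundle 𝓘(ℝ, Coord n) M} {z : N}
    (hv : ContMDiffAt 𝓘(ℝ, N) 𝓘(ℝ, Coord n).tangent ∞ v z) (hz : 0 < β (v z).1 (v z).2) :
    ContDiffAt ℝ ∞ (fun z => kropina a β m (v z).1 (v z).2) z := by
  have hA : 0 < a.inner (v z).1 (v z).2 (v z).2 := a.pos _ _ (by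
    intro h
    rw [h] at hz
    simp at hz)
  exact (((contDiffAt_metric_apply a hv).sqrt hA.ne').rpow_const_of_ne
    (Real.sqrt_pos.2 hA).ne').mul ((contDiffAt_oneForm_apply hβ hv).rpow_const_of_ne hz.ne')

/-- The parameter space `N` and the source `E` are kept general: the result serves both for the
inverse of a chart on coordinate space and for the flow as a map on `ℝ × Coord n`, followed in time.
-/
theorem contMDiffAt_mfderiv_apply {g : E → M} {s : Set E} (hs : IsOpen s)
    (hg : ContMDiffOn 𝓘(ℝ, E) 𝓘(ℝ, Coord n) ∞ g s) {q w : N → E} {z : N}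
    (hq : ContDiffAt ℝ ∞ q z) (hw : ContDiffAt ℝ ∞ w z) (hz : q z ∈ s) :
    ContMDiffAt 𝓘(ℝ, N) 𝓘(ℝ, Coord n).tangent ∞
      (fun z => (⟨g (q z), mfderiv 𝓘(ℝ, E) 𝓘(ℝ, Coord n) g (q z) (w z)⟩ :
        TangentBundle 𝓘(ℝ, Coord n) M)) z := by
  have h1 : ContMDiffAt 𝓘(ℝ, N) 𝓘(ℝ, E).tangent ∞
      (fun z => (⟨q z, w z⟩ : TangentBundle 𝓘(ℝ, E) E)) z := by
    rw [Bundle.contMDiffAt_totalSpace]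
    refine ⟨hq.contMDiffAt, ?_⟩
    simpa using hw.contMDiffAt
  have h2 := (hg.contMDiffOn_tangentMapWithin (m := ∞) (by simp) hs.uniqueMDiffOn).contMDiffAt
    (x := (⟨q z, w z⟩ : TangentBundle 𝓘(ℝ, E) E))
    ((hs.preimage (FiberBundle.continuous_proj E (TangentSpace 𝓘(ℝ, E)))).mem_nhds hz)
  refine (h2.comp z h1).congr_of_eventuallyEq ?_
  filter_upwards [hq.continuousAt.eventually_mem (hs.mem_nhds hz)] with y hy
  simp only [Function.comp, tangentMapWithin, mfderivWithin_of_isOpen hs hy]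

theorem isOpen_setOf_pos {β : (p : M) → TangentSpace 𝓘(ℝ, Coord n) p →L[ℝ] ℝ}
    (hβ : IsSmoothOneForm β) {g : E → M} {s : Set E} (hs : IsOpen s)
    (hg : ContMDiffOn 𝓘(ℝ, E) 𝓘(ℝ, Coord n) ∞ g s) :
    IsOpen {p : E × E | p.1 ∈ s ∧ 0 < β (g p.1) (mfderiv 𝓘(ℝ, E) 𝓘(ℝ, Coord n) g p.1 p.2)} := by
  rw [isOpen_iff_mem_nhds]
  rintro p ⟨hp, hpos⟩
  have h1 := (contDiffAt_oneForm_apply hβ (contMDiffAt_mfderiv_apply hs hg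
    (contDiffAt_fst (p := p)) contDiffAt_snd hp)).continuousAt
  filter_upwards [continuousAt_fst.eventually_mem (hs.mem_nhds hp),
    h1.eventually_mem (Ioi_mem_nhds hpos)] with q hq hq'
  exact ⟨hq, hq'⟩

end Smoothness

/-! ### Charts from the inverse function theorem -/

section Chart

variable {n : ℕ} {M : Type*} [TopologicalSpace M] [ChartedSpace (Coord n) M]
  [IsManifold 𝓘(ℝ, Coord n) ∞ M]

/-- The inverse function theorem: an immersion `ψ` of an open subset of the model space is locally
the inverse of a smooth chart. -/
theorem exists_chart_symm_eq {ψ : Coord n → M} {W : Set (Coord n)} (hW : IsOpen W)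
    (hψ : ContMDiffOn 𝓘(ℝ, Coord n) 𝓘(ℝ, Coord n) ∞ ψ W)
    (hinj : ∀ z ∈ W, Function.Injective (mfderiv 𝓘(ℝ, Coord n) 𝓘(ℝ, Coord n) ψ z))
    {z₀ : Coord n} (hz₀ : z₀ ∈ W) :
    ∃ e ∈ IsManifold.maximalAtlas 𝓘(ℝ, Coord n) ∞ M, z₀ ∈ e.target ∧ e.target ⊆ W ∧
      ∀ z ∈ e.target, e.symm z = ψ z := by
  let κ := chartAt (Coord n) (ψ z₀)
  have hκ : κ ∈ IsManifold.maximalAtlas 𝓘(ℝ, Coord n) ∞ M :=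
    IsManifold.chart_mem_maximalAtlas (ψ z₀)
  have hκd : κ.MDifferentiable 𝓘(ℝ, Coord n) 𝓘(ℝ, Coord n) := mdifferentiable_chart _
  let W₁ := W ∩ ψ ⁻¹' κ.source
  have hW₁ : IsOpen W₁ := hψ.continuousOn.isOpen_inter_preimage hW κ.open_source
  have hz₁ : z₀ ∈ W₁ := ⟨hz₀, mem_chart_source _ _⟩
  let h := κ ∘ ψ
  have hh : ContDiffOn ℝ ∞ h W₁ :=
    ((contMDiffOn_of_mem_maximalAtlas hκ).comp (hψ.mono Set.inter_subset_left)
      (fun z hz => hz.2)).contDiffOn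
  have hψd : ∀ z ∈ W₁, MDifferentiableAt 𝓘(ℝ, Coord n) 𝓘(ℝ, Coord n) ψ z := fun z hz =>
    (hψ.contMDiffAt (hW.mem_nhds hz.1)).mdifferentiableAt (by simp)
  -- Invertibility is needed on all of `W₁`, not only at `z₀`: the local inverse must be smooth at
  -- every point of its domain to yield a chart of the maximal atlas.
  have hder : ∀ z ∈ W₁, ∃ L : Coord n ≃L[ℝ] Coord n,
      HasFDerivAt h (L : Coord n →L[ℝ] Coord n) z := by
    intro z hz
    have h1 := (hh.contDiffAt (hW₁.mem_nhds hz)).differentiableAt (by simp)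
    have h2 : fderiv ℝ h z = (mfderiv 𝓘(ℝ, Coord n) 𝓘(ℝ, Coord n) κ (ψ z)).comp
        (mfderiv 𝓘(ℝ, Coord n) 𝓘(ℝ, Coord n) ψ z) := by
      rw [← mfderiv_eq_fderiv]
      exact mfderiv_comp z (hκd.mdifferentiableAt hz.2) (hψd z hz)
    have h3 : Function.Injective (fderiv ℝ h z) := by
      rw [h2]
      exact (hκd.mfderiv_injective hz.2).comp (hinj z hz.1)
    refine ⟨(LinearEquiv.ofInjectiveEndo (fderiv ℝ h z : Coord n →ₗ[ℝ] Coord n)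
      h3).toContinuousLinearEquiv, ?_⟩
    exact h1.hasFDerivAt.congr_fderiv (by ext v; rfl)
  obtain ⟨L, hL⟩ := hder z₀ hz₁
  have hc := hh.contDiffAt (hW₁.mem_nhds hz₁)
  let H := (hc.toOpenPartialHomeomorph h hL (by simp)).restrOpen W₁ hW₁
  have hHW : H.source ⊆ W₁ := fun z hz => hz.2
  have hHc : ∀ z, H z = h z := fun z => rfl
  have hz₂ : z₀ ∈ H.source := ⟨hc.mem_toOpenPartialHomeomorph_source hL (by simp), hz₁⟩
  have hHs : ContDiffOn ℝ ∞ H.symm H.target := by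
    intro y hy
    have hy' := H.map_target hy
    obtain ⟨L', hL'⟩ := hder _ (hHW hy')
    exact (H.contDiffAt_symm hy hL'
      (hh.contDiffAt (hW₁.mem_nhds (hHW hy')))).contDiffWithinAt
  have hmap : ∀ z ∈ H.source, H z ∈ κ.target := fun z hz => κ.map_source (hHW hz).2
  have htar : (κ ≫ₕ H.symm).target = H.source := by
    ext z
    simp only [OpenPartialHomeomorph.trans_target, OpenPartialHomeomorph.symm_target,
      OpenPartialHomeomorph.symm_symm, Set.mem_inter_iff, Set.mem_preimage]
    exact ⟨fun h => h.1, fun h => ⟨h, hmap z h⟩⟩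
  have hsymm : ∀ z ∈ H.source, (κ ≫ₕ H.symm).symm z = ψ z := fun z hz =>
    κ.left_inv (hHW hz).2
  refine ⟨κ ≫ₕ H.symm, ?_, ?_, ?_, ?_⟩
  · refine OpenPartialHomeomorph.mem_maximalAtlas_of_contMDiffOn (I := 𝓘(ℝ, Coord n)) (n := ∞)
      (κ ≫ₕ H.symm) ?_ ?_
    · refine hHs.contMDiffOn.comp ((contMDiffOn_of_mem_maximalAtlas hκ).mono ?_) ?_
      · exact fun p hp => hp.1
      · exact fun p hp => hp.2
    · rw [htar]
      exact (hψ.mono fun z hz => (hHW hz).1).congr hsymm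
  · rw [htar]; exact hz₂
  · rw [htar]; exact fun z hz => (hHW hz).1
  · rw [htar]; exact hsymm

end Chart

/-! ### Local flows in coordinates -/

/-- The domain of a flow in the coordinates of a chart. -/
def flowDomain {n : ℕ} {M : Type*} [TopologicalSpace M] (D : Set (ℝ × M))
    (e₀ : OpenPartialHomeomorph M (Coord n)) :
    Set (ℝ × Coord n) :=
  {p | p.2 ∈ e₀.target ∧ (p.1, e₀.symm p.2) ∈ D}

theorem isOpen_flowDomain {n : ℕ} {M : Type*} [TopologicalSpace M] {D : Set (ℝ × M)}
    {e₀ : OpenPartialHomeomorph M (Coord n)} (hD : IsOpen D) : IsOpen (flowDomain D e₀) := by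
  have h : ContinuousOn (fun p : ℝ × Coord n => (p.1, e₀.symm p.2)) (Prod.snd ⁻¹' e₀.target) :=
    continuousOn_fst.prodMk (e₀.continuousOn_symm.comp continuousOn_snd fun p hp => hp)
  exact h.isOpen_inter_preimage (e₀.open_target.preimage continuous_snd) hD

section LocalFlow

variable {n : ℕ} {M : Type*} [TopologicalSpace M] [ChartedSpace (Coord n) M]
  {V : (p : M) → TangentSpace 𝓘(ℝ, Coord n) p} {D : Set (ℝ × M)} {Φ : ℝ × M → M}
  {e₀ : OpenPartialHomeomorph M (Coord n)} {t : ℝ} {z : Coord n}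

theorem mdifferentiable_of_mem_maximalAtlas
    (he : e₀ ∈ IsManifold.maximalAtlas 𝓘(ℝ, Coord n) ∞ M) :
    e₀.MDifferentiable 𝓘(ℝ, Coord n) 𝓘(ℝ, Coord n) :=
  ⟨(contMDiffOn_of_mem_maximalAtlas he).mdifferentiableOn (by simp),
    (contMDiffOn_symm_of_mem_maximalAtlas he).mdifferentiableOn (by simp)⟩

namespace IsLocalFlow

theorem contMDiffOn_chart (h : IsLocalFlow V D Φ)
    (he : e₀ ∈ IsManifold.maximalAtlas 𝓘(ℝ, Coord n) ∞ M) :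
    ContMDiffOn 𝓘(ℝ, ℝ × Coord n) 𝓘(ℝ, Coord n) ∞
      (fun p : ℝ × Coord n => Φ (p.1, e₀.symm p.2)) (flowDomain D e₀) := by
  refine h.smooth.comp (ContMDiffOn.prodMk ?_ ?_) fun p hp => hp.2
  · exact contDiff_fst.contMDiff.contMDiffOn
  · exact (contMDiffOn_symm_of_mem_maximalAtlas he).comp contDiff_snd.contMDiff.contMDiffOn
      fun p hp => hp.1

theorem mdifferentiableAt_slice (h : IsLocalFlow V D Φ) {x : M} (hx : (t, x) ∈ D) :
    MDifferentiableAt 𝓘(ℝ, Coord n) 𝓘(ℝ, Coord n) (fun z => Φ (t, z)) x := by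
  have h1 := (h.smooth.contMDiffAt (h.isOpen.mem_nhds hx)).mdifferentiableAt (by simp)
  exact MDifferentiableAt.comp (I' := 𝓘(ℝ, ℝ).prod 𝓘(ℝ, Coord n)) x (f := fun z : M => (t, z))
    (g := Φ) h1 (mdifferentiableAt_const.prodMk mdifferentiableAt_id)

theorem mfderiv_chart_slice (h : IsLocalFlow V D Φ)
    (he : e₀ ∈ IsManifold.maximalAtlas 𝓘(ℝ, Coord n) ∞ M) (hz : (t, z) ∈ flowDomain D e₀)
    (y : Coord n) :
    mfderiv 𝓘(ℝ, Coord n) 𝓘(ℝ, Coord n) (fun z => Φ (t, e₀.symm z)) z y =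
      mfderiv 𝓘(ℝ, Coord n) 𝓘(ℝ, Coord n) (fun x => Φ (t, x)) (e₀.symm z)
        (mfderiv 𝓘(ℝ, Coord n) 𝓘(ℝ, Coord n) e₀.symm z y) := by
  have h1 := mfderiv_comp z (h.mdifferentiableAt_slice hz.2)
    ((mdifferentiable_of_mem_maximalAtlas he).mdifferentiableAt_symm hz.1)
  exact congrArg (fun L : Coord n →L[ℝ] Coord n => L y) h1

/-- Rewrites the spatial derivative of `φ_t` as a derivative of a single map of `(t, z)`, whose
smooth dependence on `t` is then available. -/
theorem mfderiv_chart (h : IsLocalFlow V D Φ)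
    (he : e₀ ∈ IsManifold.maximalAtlas 𝓘(ℝ, Coord n) ∞ M) (hz : (t, z) ∈ flowDomain D e₀)
    (y : Coord n) :
    mfderiv 𝓘(ℝ, ℝ × Coord n) 𝓘(ℝ, Coord n) (fun p : ℝ × Coord n => Φ (p.1, e₀.symm p.2))
        (t, z) ((0, y) : ℝ × Coord n) =
      mfderiv 𝓘(ℝ, Coord n) 𝓘(ℝ, Coord n) (fun x => Φ (t, x)) (e₀.symm z)
        (mfderiv 𝓘(ℝ, Coord n) 𝓘(ℝ, Coord n) e₀.symm z y) := by
  rw [← h.mfderiv_chart_slice he hz]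
  have h1 : MDifferentiableAt 𝓘(ℝ, ℝ × Coord n) 𝓘(ℝ, Coord n)
      (fun p : ℝ × Coord n => Φ (p.1, e₀.symm p.2)) (t, z) :=
    ((h.contMDiffOn_chart he).contMDiffAt ((isOpen_flowDomain h.isOpen).mem_nhds
      hz)).mdifferentiableAt (by simp)
  have h2 : HasFDerivAt (fun z : Coord n => (t, z)) (ContinuousLinearMap.inr ℝ ℝ (Coord n)) z :=
    hasFDerivAt_prodMk_right t z
  have h3 := (h1.hasMFDerivAt.comp z h2.hasMFDerivAt).mfderiv
  exact (congrArg (fun L : Coord n →L[ℝ] Coord n => L y) h3).symm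

end IsLocalFlow

end LocalFlow

/-! ### Conformal flows of an `m`-Kropina metric -/

section Flow

variable {n : ℕ} {M : Type*} [TopologicalSpace M] [ChartedSpace (Coord n) M]
  [IsManifold 𝓘(ℝ, Coord n) ∞ M]
  {a : SmoothRiemannianMetric n M} {β : (p : M) → TangentSpace 𝓘(ℝ, Coord n) p →L[ℝ] ℝ} {m : ℝ}
  {V : (p : M) → TangentSpace 𝓘(ℝ, Coord n) p} {D : Set (ℝ × M)} {Φ : ℝ × M → M}
  {σ : ℝ → M → ℝ} {e₀ : OpenPartialHomeomorph M (Coord n)} {t : ℝ} {z : Coord n}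

theorem exists_apply_pos {E : Type*} [AddCommGroup E] [Module ℝ E] [TopologicalSpace E]
    {b : E →L[ℝ] ℝ} (hb : b ≠ 0) : ∃ y, 0 < b y := by
  obtain ⟨y, hy⟩ := DFunLike.ne_iff.1 hb
  rcases lt_or_gt_of_ne (show b y ≠ 0 from hy) with h | h
  · exact ⟨-y, by simpa using h⟩
  · exact ⟨y, h⟩

theorem kropina_pos {x : M} {y : TangentSpace 𝓘(ℝ, Coord n) x} (hy : 0 < β x y) :
    0 < kropina a β m x y := by
  have hA : 0 < a.inner x y y := a.pos _ _ (by
    rintro rfl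
    simp at hy)
  exact mul_pos (Real.rpow_pos_of_pos (Real.sqrt_pos.2 hA) _) (Real.rpow_pos_of_pos hy _)

theorem exists_inChart_kropina_eq (hβ0 : ∀ p, β p ≠ 0)
    (he₀ : e₀ ∈ IsManifold.maximalAtlas 𝓘(ℝ, Coord n) ∞ M) (hz : z ∈ e₀.target) :
    ∃ (A : Coord n →L[ℝ] Coord n →L[ℝ] ℝ) (B : Coord n →L[ℝ] ℝ),
      (∀ v w, A v w = A w v) ∧ (∀ v, v ≠ 0 → 0 < A v v) ∧ B ≠ 0 ∧
      (∀ y, B y = β (e₀.symm z) (mfderiv 𝓘(ℝ, Coord n) 𝓘(ℝ, Coord n) e₀.symm z y)) ∧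
      ∀ y, inChart e₀ (kropina a β m) z y = Real.sqrt (A y y) ^ (1 - m) * B y ^ m := by
  have hd₀ := mdifferentiable_of_mem_maximalAtlas he₀
  obtain ⟨P, hP⟩ : ∃ P : Coord n →L[ℝ] Coord n,
      P = mfderiv 𝓘(ℝ, Coord n) 𝓘(ℝ, Coord n) e₀.symm z := ⟨_, rfl⟩
  have hPbij : Function.Bijective P := by
    rw [hP]
    exact hd₀.symm.mfderiv_bijective hz
  obtain ⟨A, hA⟩ : ∃ A : Coord n →L[ℝ] Coord n →L[ℝ] ℝ, ∀ v w, A v w = a.inner (e₀.symm z) v w :=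
    ⟨a.inner (e₀.symm z), fun _ _ => rfl⟩
  obtain ⟨B, hB⟩ : ∃ B : Coord n →L[ℝ] ℝ, ∀ v, B v = β (e₀.symm z) v :=
    ⟨β (e₀.symm z), fun _ => rfl⟩
  refine ⟨A.bilinearComp P P, B.comp P, fun v w => ?_, fun v hv => ?_, fun h0 => ?_,
    fun y => ?_, fun y => ?_⟩
  · rw [ContinuousLinearMap.bilinearComp_apply, ContinuousLinearMap.bilinearComp_apply, hA, hA]
    exact a.symm _ _ _
  · rw [ContinuousLinearMap.bilinearComp_apply, hA]
    exact a.pos _ _ fun h0 => hv (hPbij.1 (h0.trans (map_zero P).symm))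
  · obtain ⟨y, hy⟩ := exists_apply_pos (hβ0 (e₀.symm z))
    obtain ⟨w, hw⟩ := hPbij.2 y
    have h1 := congrArg (fun φ : Coord n →L[ℝ] ℝ => φ w) h0
    simp only [ContinuousLinearMap.comp_apply, hw, zero_apply] at h1
    exact hy.ne' ((hB y).symm.trans h1)
  · rw [ContinuousLinearMap.comp_apply, hB, hP]
    rfl
  · rw [ContinuousLinearMap.comp_apply, ContinuousLinearMap.bilinearComp_apply, hA, hB, hP]
    rfl

/-- Let an `m`-Kropina metric be a Landsberg metric, or a Douglas metric with `m ≠ -1`. If its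
expressions in two charts differ by a conformal factor, then this factor is locally constant. -/
theorem hasFDerivAt_zero_of_inChart_eq {e : OpenPartialHomeomorph M (Coord n)} {u : Coord n → ℝ}
    (hβ : IsSmoothOneForm β) (hβ0 : ∀ p, β p ≠ 0) (hm0 : m ≠ 0) (hm1 : m ≠ 1)
    (hF : (3 ≤ n ∧ IsLandsberg (kropinaDomain β) (kropina a β m)) ∨
      (2 ≤ n ∧ m ≠ -1 ∧ IsDouglas (kropinaDomain β) (kropina a β m)))
    (he₀ : e₀ ∈ IsManifold.maximalAtlas 𝓘(ℝ, Coord n) ∞ M)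
    (he : e ∈ IsManifold.maximalAtlas 𝓘(ℝ, Coord n) ∞ M) {z₀ : Coord n} (hze : z₀ ∈ e.target)
    (hsub : e.target ⊆ e₀.target)
    (hpos : ∀ z ∈ e.target, ∀ y : Coord n,
      0 < β (e₀.symm z) (mfderiv 𝓘(ℝ, Coord n) 𝓘(ℝ, Coord n) e₀.symm z y) →
      0 < β (e.symm z) (mfderiv 𝓘(ℝ, Coord n) 𝓘(ℝ, Coord n) e.symm z y))
    (hconf : ∀ z ∈ e.target, ∀ y : Coord n,
      0 < β (e₀.symm z) (mfderiv 𝓘(ℝ, Coord n) 𝓘(ℝ, Coord n) e₀.symm z y) →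
      inChart e (kropina a β m) z y = Real.exp (u z) * inChart e₀ (kropina a β m) z y) :
    HasFDerivAt u (0 : Coord n →L[ℝ] ℝ) z₀ := by
  have hz₀ := hsub hze
  have hd₀ := mdifferentiable_of_mem_maximalAtlas he₀
  obtain ⟨f, hf⟩ : ∃ f, f = inChart e₀ (kropina a β m) := ⟨_, rfl⟩
  obtain ⟨f', hf'⟩ : ∃ f', f' = inChart e (kropina a β m) := ⟨_, rfl⟩
  let O : Set (Coord n × Coord n) := {p | p.1 ∈ e.target ∧
    0 < β (e₀.symm p.1) (mfderiv 𝓘(ℝ, Coord n) 𝓘(ℝ, Coord n) e₀.symm p.1 p.2)}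
  have hs₀ : ContMDiffOn 𝓘(ℝ, Coord n) 𝓘(ℝ, Coord n) ∞ e₀.symm e.target :=
    (contMDiffOn_symm_of_mem_maximalAtlas he₀).mono hsub
  have hO : IsOpen O := isOpen_setOf_pos hβ e.open_target hs₀
  have hfs : ContDiffOn ℝ ∞ (Function.uncurry f) O := by
    rw [hf]
    exact fun p hp =>
      (contDiffAt_kropina a hβ m (contMDiffAt_mfderiv_apply e.open_target hs₀
        (contDiffAt_fst (p := p)) contDiffAt_snd hp.1) hp.2).contDiffWithinAt
  have hfs' : ContDiffOn ℝ ∞ (Function.uncurry f') O := by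
    rw [hf']
    exact fun p hp => (contDiffAt_kropina a hβ m (contMDiffAt_mfderiv_apply e.open_target
      (contMDiffOn_symm_of_mem_maximalAtlas he)
      (contDiffAt_fst (p := p)) contDiffAt_snd hp.1)
      (hpos p.1 hp.1 p.2 hp.2)).contDiffWithinAt
  have hff : ∀ p ∈ O, f' p.1 p.2 = Real.exp (u p.1) * f p.1 p.2 := by
    rw [hf, hf']
    exact fun p hp => hconf p.1 hp.1 p.2 hp.2
  have hpf : ∀ p ∈ O, 0 < f p.1 p.2 := by
    rw [hf]
    exact fun p hp => kropina_pos hp.2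
  obtain ⟨a₀, b₀, hsymm₀, hpos₀, hb₀, hb₀', hfx⟩ :=
    exists_inChart_kropina_eq (a := a) (m := m) hβ0 he₀ hz₀
  rw [← hf] at hfx
  have hx : ∀ y, 0 < b₀ y → (z₀, y) ∈ O := fun y hy => ⟨hze, by rwa [hb₀' y] at hy⟩
  -- No regularity of `u` is assumed. It is recovered as `log f' - log f` at a fixed admissible `y`.
  have hu : DifferentiableAt ℝ u z₀ := by
    obtain ⟨y, hy⟩ := exists_apply_pos hb₀
    have h1 := (LocalFinsler.hasFDerivAt_slice_left hO hfs (hx y hy)).differentiableAt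
    have h2 := (LocalFinsler.hasFDerivAt_slice_left hO hfs' (hx y hy)).differentiableAt
    have hne : f z₀ y ≠ 0 := (hpf _ (hx y hy)).ne'
    have hne' : f' z₀ y ≠ 0 := by
      rw [hff _ (hx y hy)]
      exact mul_ne_zero (Real.exp_ne_zero _) hne
    have h3 : DifferentiableAt ℝ (fun z => Real.log (f' z y) - Real.log (f z y)) z₀ :=
      (h2.log hne').fun_sub (h1.log hne)
    refine h3.congr_of_eventuallyEq ?_
    filter_upwards [(Continuous.prodMk_left y).continuousAt.eventually_mem
      (hO.mem_nhds (hx y hy))] with z hz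
    rw [hff _ hz, Real.log_mul (Real.exp_ne_zero _) (hpf _ hz).ne', Real.log_exp,
      add_sub_cancel_right]
  have hreg : ∀ y, (z₀, y) ∈ LocalFinsler.regularSet f O →
      IsRegularPoint (kropinaDomain β) (kropina a β m) e₀ z₀ y :=
    fun y hy => ⟨hz₀, hy.1.2, by rw [← hf]; exact hy.2⟩
  have hreg' : ∀ y, (z₀, y) ∈ LocalFinsler.regularSet f' O →
      IsRegularPoint (kropinaDomain β) (kropina a β m) e z₀ y :=
    fun y hy => ⟨hze, hpos z₀ hze y hy.1.2, by rw [← hf']; exact hy.2⟩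
  have hzero : fderiv ℝ u z₀ = 0 := by
    rcases hF with ⟨hn, hL⟩ | ⟨hn, hm1', hD⟩
    · exact LocalFinsler.fderiv_eq_zero_of_landsberg (by omega) hO hfs hfs' hff hx hu hsymm₀
        hpos₀ hb₀ hm0 hm1 (fun y _ => hfx y)
        (fun y hy => by rw [hf]; exact hL e₀ he₀ z₀ y (hreg y hy))
        (fun y hy => by rw [hf']; exact hL e he z₀ y (hreg' y hy))
    · exact LocalFinsler.fderiv_eq_zero_of_douglas hn hO hfs hfs' hff hx hu hsymm₀
        hpos₀ hb₀ hm0 hm1 hm1' (fun y _ => hfx y)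
        (fun y hy => by rw [hf]; exact hD e₀ he₀ z₀ y (hreg y hy))
        (fun y hy => by rw [hf']; exact hD e he z₀ y (hreg' y hy))
  rw [← hzero]
  exact hu.hasFDerivAt

namespace IsConformalFlow

/-- A kernel vector `w` cannot be detected by the pulled-back metric, so both the domain `β > 0` and
`F` are invariant under translation by multiples of `w`. The first fact forces `β(w) = 0`; the
second then makes `α` constant on `y + s w`, so `w = 0`. The group law of the flow is not needed. -/
theorem mfderiv_injective (h : IsConformalFlow (kropinaDomain β) (kropina a β m) V D Φ σ)
    (hβ0 : ∀ p, β p ≠ 0) (hm1 : m ≠ 1) {x : M} (hx : (t, x) ∈ D) :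
    Function.Injective (mfderiv 𝓘(ℝ, Coord n) 𝓘(ℝ, Coord n) (fun z => Φ (t, z)) x) := by
  set Q := mfderiv 𝓘(ℝ, Coord n) 𝓘(ℝ, Coord n) (fun z => Φ (t, z)) x with hQ
  rw [injective_iff_map_eq_zero]
  intro w hw
  obtain ⟨y, hy⟩ := exists_apply_pos (hβ0 x)
  have hQs : ∀ s : ℝ, Q (y + s • w) = Q y := fun s => by simp [hw]
  have hmem : ∀ s : ℝ, 0 < β x (y + s • w) := fun s => by
    refine (h.mem_iff t x hx _).1 ?_
    rw [← hQ, hQs]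
    exact (h.mem_iff t x hx _).2 hy
  have hβw : β x w = 0 := by
    by_contra hne
    have := hmem (-(β x y) / β x w)
    rw [map_add, map_smul, smul_eq_mul, div_mul_cancel₀ _ hne] at this
    linarith
  have hF : ∀ s : ℝ, kropina a β m x (y + s • w) = kropina a β m x y := fun s => by
    have h1 := h.pullback t x hx _ (hmem s)
    have h2 := h.pullback t x hx _ hy
    rw [← hQ, hQs] at h1
    rw [← hQ, h1] at h2
    exact mul_left_cancel₀ (Real.exp_ne_zero _) h2
  have hpos : ∀ s : ℝ, 0 < a.inner x (y + s • w) (y + s • w) := fun s => a.pos _ _ (by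
    intro h0
    have := hmem s
    rw [h0] at this
    simp at this)
  have hypos : 0 < a.inner x y y := by simpa using hpos 0
  have hA : ∀ s : ℝ, a.inner x (y + s • w) (y + s • w) = a.inner x y y := fun s => by
    have h1 := hF s
    simp only [kropina] at h1
    rw [map_add (β x), map_smul, hβw, smul_zero, add_zero] at h1
    have h2 := mul_right_cancel₀ (Real.rpow_pos_of_pos hy _).ne' h1
    have h3 := (Real.rpow_left_inj (Real.sqrt_nonneg _) (Real.sqrt_nonneg _)
      (sub_ne_zero.2 hm1.symm)).1 h2
    exact (Real.sqrt_inj (hpos s).le hypos.le).1 h3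
  -- Adding the cases `s = 1` and `s = -1` cancels the cross terms and leaves `2 a(w, w) = 0`.
  have e1 := hA 1
  have e2 := hA (-1)
  simp only [map_add, map_smul, add_apply, smul_apply, smul_eq_mul] at e1 e2
  by_contra hne
  have := a.pos x w hne
  linarith

/-- The pullback of `F` by `φ_t` is thereby its expression in another chart, so the curvature
hypotheses transfer to it without any transformation law for the tensors. -/
theorem exists_chart_flow (h : IsConformalFlow (kropinaDomain β) (kropina a β m) V D Φ σ)
    (hβ0 : ∀ p, β p ≠ 0) (hm1 : m ≠ 1)
    (he₀ : e₀ ∈ IsManifold.maximalAtlas 𝓘(ℝ, Coord n) ∞ M) {z₀ : Coord n}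
    (hz₀ : (t, z₀) ∈ flowDomain D e₀) :
    ∃ e ∈ IsManifold.maximalAtlas 𝓘(ℝ, Coord n) ∞ M, z₀ ∈ e.target ∧
      (∀ z ∈ e.target, (t, z) ∈ flowDomain D e₀) ∧ ∀ z ∈ e.target, ∀ y : Coord n,
      (⟨e.symm z, mfderiv 𝓘(ℝ, Coord n) 𝓘(ℝ, Coord n) e.symm z y⟩ :
        TangentBundle 𝓘(ℝ, Coord n) M) =
      ⟨Φ (t, e₀.symm z), mfderiv 𝓘(ℝ, Coord n) 𝓘(ℝ, Coord n) (fun x => Φ (t, x)) (e₀.symm z)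
        (mfderiv 𝓘(ℝ, Coord n) 𝓘(ℝ, Coord n) e₀.symm z y)⟩ := by
  have hd₀ := mdifferentiable_of_mem_maximalAtlas he₀
  let W : Set (Coord n) := {z | (t, z) ∈ flowDomain D e₀}
  have hW : IsOpen W := (isOpen_flowDomain h.flow.isOpen).preimage (Continuous.prodMk_right t)
  have hψ : ContMDiffOn 𝓘(ℝ, Coord n) 𝓘(ℝ, Coord n) ∞ (fun z => Φ (t, e₀.symm z)) W :=
    (h.flow.contMDiffOn_chart he₀).comp
      (ContDiff.contMDiff (contDiff_const.prodMk contDiff_id)).contMDiffOn fun z hz => hz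
  obtain ⟨e, he, hze, heW, hsymm⟩ := exists_chart_symm_eq hW hψ (fun z hz => by
    have h1 : ⇑(mfderiv 𝓘(ℝ, Coord n) 𝓘(ℝ, Coord n) (fun z => Φ (t, e₀.symm z)) z) =
      fun y => mfderiv 𝓘(ℝ, Coord n) 𝓘(ℝ, Coord n) (fun x => Φ (t, x)) (e₀.symm z)
        (mfderiv 𝓘(ℝ, Coord n) 𝓘(ℝ, Coord n) e₀.symm z y) :=
      funext fun y => h.flow.mfderiv_chart_slice he₀ hz y
    rw [h1]
    exact (h.mfderiv_injective hβ0 hm1 hz.2).comp (hd₀.symm.mfderiv_injective hz.1)) hz₀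
  refine ⟨e, he, hze, fun z hz => heW hz, fun z hz y => ?_⟩
  have h1 : (e.symm : Coord n → M) =ᶠ[𝓝 z] fun z => Φ (t, e₀.symm z) := by
    filter_upwards [e.open_target.mem_nhds hz] with w hw using hsymm w hw
  have h2 : (mfderiv 𝓘(ℝ, Coord n) 𝓘(ℝ, Coord n) e.symm z : Coord n →L[ℝ] Coord n) =
    mfderiv 𝓘(ℝ, Coord n) 𝓘(ℝ, Coord n) (fun z => Φ (t, e₀.symm z)) z := h1.mfderiv_eq
  have h3 : (mfderiv 𝓘(ℝ, Coord n) 𝓘(ℝ, Coord n) e.symm z y : Coord n) =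
      mfderiv 𝓘(ℝ, Coord n) 𝓘(ℝ, Coord n) (fun x => Φ (t, x)) (e₀.symm z)
        (mfderiv 𝓘(ℝ, Coord n) 𝓘(ℝ, Coord n) e₀.symm z y) :=
    (congrArg (fun L : Coord n →L[ℝ] Coord n => L y) h2).trans
      (h.flow.mfderiv_chart_slice he₀ (heW hz) y)
  exact Bundle.TotalSpace.ext (hsymm z hz) (heq_of_eq h3)

/-- The conformal factor of a flow is locally constant. -/
theorem hasFDerivAt_factor (h : IsConformalFlow (kropinaDomain β) (kropina a β m) V D Φ σ)
    (hβ : IsSmoothOneForm β) (hβ0 : ∀ p, β p ≠ 0) (hm0 : m ≠ 0) (hm1 : m ≠ 1)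
    (hF : (3 ≤ n ∧ IsLandsberg (kropinaDomain β) (kropina a β m)) ∨
      (2 ≤ n ∧ m ≠ -1 ∧ IsDouglas (kropinaDomain β) (kropina a β m)))
    (he₀ : e₀ ∈ IsManifold.maximalAtlas 𝓘(ℝ, Coord n) ∞ M) {z₀ : Coord n}
    (hz₀ : (t, z₀) ∈ flowDomain D e₀) :
    HasFDerivAt (fun z => σ t (e₀.symm z)) (0 : Coord n →L[ℝ] ℝ) z₀ := by
  obtain ⟨e, he, hze, heW, htan⟩ := h.exists_chart_flow hβ0 hm1 he₀ hz₀
  have hu := hasFDerivAt_zero_of_inChart_eq (u := fun z => 2 * σ t (e₀.symm z)) hβ hβ0 hm0 hm1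
    hF he₀ he hze (fun z hz => (heW z hz).1)
    (fun z hz y hy => by
      have h1 := (h.mem_iff t _ (heW z hz).2 _).2 hy
      have h2 := congrArg (fun v : TangentBundle 𝓘(ℝ, Coord n) M => β v.1 v.2) (htan z hz y)
      exact lt_of_lt_of_eq h1 h2.symm)
    (fun z hz y hy => by
      have h1 := h.pullback t _ (heW z hz).2 _ hy
      have h2 := congrArg (fun v : TangentBundle 𝓘(ℝ, Coord n) M => kropina a β m v.1 v.2)
        (htan z hz y)
      exact h2.trans h1)
  have h1 := hu.const_mul (1 / 2 : ℝ)
  rw [smul_zero] at h1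
  refine h1.congr_of_eventuallyEq (Filter.Eventually.of_forall fun z => ?_)
  simp only
  ring

/-- The conformal factor of a flow is differentiable in time. -/
theorem exists_hasDerivAt_factor
    (h : IsConformalFlow (kropinaDomain β) (kropina a β m) V D Φ σ)
    (hβ : IsSmoothOneForm β) (hβ0 : ∀ p, β p ≠ 0) (x : M) :
    ∃ c : ℝ, HasDerivAt (fun t => σ t x) c 0 := by
  obtain ⟨e₀, he₀, hx⟩ : ∃ e₀ ∈ IsManifold.maximalAtlas 𝓘(ℝ, Coord n) ∞ M, x ∈ e₀.source :=
    ⟨chartAt (Coord n) x, IsManifold.chart_mem_maximalAtlas x, mem_chart_source _ x⟩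
  obtain ⟨z, hz, rfl⟩ : ∃ z ∈ e₀.target, e₀.symm z = x :=
    ⟨e₀ x, e₀.map_source hx, e₀.left_inv hx⟩
  have hG : (0, z) ∈ flowDomain D e₀ := ⟨hz, h.flow.zero_mem _⟩
  obtain ⟨v, hv⟩ := exists_apply_pos (hβ0 (e₀.symm z))
  obtain ⟨y, rfl⟩ :=
    (mdifferentiable_of_mem_maximalAtlas he₀).symm.mfderiv_surjective hz v
  -- Along one fixed tangent vector, `F` evaluated on its image under `φ_t` is smooth in `t`, and
  -- `σ_t` is half the logarithm of its quotient by the initial value.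
  let g : ℝ × Coord n → M := fun p => Φ (p.1, e₀.symm p.2)
  let F : ℝ → ℝ := fun t => kropina a β m (g (t, z))
    (mfderiv 𝓘(ℝ, ℝ × Coord n) 𝓘(ℝ, Coord n) g (t, z) ((0, y) : ℝ × Coord n))
  have hFd : ContDiffAt ℝ ∞ F 0 := by
    refine contDiffAt_kropina a hβ m (contMDiffAt_mfderiv_apply (q := fun t => (t, z))
      (w := fun _ => ((0, y) : ℝ × Coord n)) (isOpen_flowDomain h.flow.isOpen)
      (h.flow.contMDiffOn_chart he₀) (contDiffAt_id.prodMk contDiffAt_const)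
      contDiffAt_const hG) ?_
    have h1 := (h.mem_iff 0 (e₀.symm z) hG.2 _).2 hv
    exact lt_of_lt_of_eq h1
      (congrArg (β (Φ (0, e₀.symm z))) (h.flow.mfderiv_chart he₀ hG y).symm)
  have hK := kropina_pos (a := a) (m := m) hv
  obtain ⟨K, hKdef⟩ : ∃ K, K = kropina a β m (e₀.symm z)
    (mfderiv 𝓘(ℝ, Coord n) 𝓘(ℝ, Coord n) e₀.symm z y) := ⟨_, rfl⟩
  rw [← hKdef] at hK
  have hFe : ∀ t, (t, z) ∈ flowDomain D e₀ → F t = Real.exp (2 * σ t (e₀.symm z)) * K := by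
    intro t ht
    rw [hKdef]
    exact (congrArg (kropina a β m (Φ (t, e₀.symm z))) (h.flow.mfderiv_chart he₀ ht y)).trans
      (h.pullback t (e₀.symm z) ht.2 _ hv)
  have hF0 : F 0 / K ≠ 0 := by
    rw [hFe 0 hG]
    exact div_ne_zero (mul_ne_zero (Real.exp_ne_zero _) hK.ne') hK.ne'
  have hd : DifferentiableAt ℝ (fun t => (1 / 2 : ℝ) * Real.log (F t / K)) 0 :=
    (((hFd.differentiableAt (by simp)).div_const K).log hF0).const_mul _
  refine ⟨_, (hd.congr_of_eventuallyEq ?_).hasDerivAt⟩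
  filter_upwards [(Continuous.prodMk_left z).continuousAt.eventually_mem
    ((isOpen_flowDomain h.flow.isOpen).mem_nhds hG)] with t ht
  rw [hFe t ht, mul_div_assoc, div_self hK.ne', mul_one, Real.log_exp]
  ring

end IsConformalFlow

end Flow

end

/-! ### Constancy of the conformal factor -/

theorem theorem5p2 {n : ℕ} {M : Type*} [TopologicalSpace M] [T2Space M]
    [SecondCountableTopology M] [ConnectedSpace M]
    [ChartedSpace (Coord n) M] [IsManifold 𝓘(ℝ, Coord n) ∞ M]
    (a : SmoothRiemannianMetric n M)
    (β : (p : M) → TangentSpace 𝓘(ℝ, Coord n) p →L[ℝ] ℝ) (hβ : IsSmoothOneForm β)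
    (hβ0 : ∀ p, β p ≠ 0)
    (m : ℝ) (hm0 : m ≠ 0) (hm1 : m ≠ 1)
    (hF : (3 ≤ n ∧ IsLandsberg (kropinaDomain β) (kropina a β m)) ∨
      (2 ≤ n ∧ m ≠ -1 ∧ IsDouglas (kropinaDomain β) (kropina a β m)))
    (V : (p : M) → TangentSpace 𝓘(ℝ, Coord n) p) (hV : IsSmoothField V)
    (hconf : IsConformalField (kropinaDomain β) (kropina a β m) V) :
    IsHomotheticField (kropinaDomain β) (kropina a β m) V := by
  obtain ⟨D, Φ, σ, h⟩ := hconf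
  choose c hc using h.exists_hasDerivAt_factor hβ hβ0
  have hloc : IsLocallyConstant c := by
    rw [IsLocallyConstant.iff_eventually_eq]
    intro x
    let e₀ := chartAt (Coord n) x
    have he₀ : e₀ ∈ IsManifold.maximalAtlas 𝓘(ℝ, Coord n) ∞ M :=
      IsManifold.chart_mem_maximalAtlas x
    have hx : x ∈ e₀.source := mem_chart_source _ x
    have hG : ((0 : ℝ), e₀ x) ∈ flowDomain D e₀ :=
      ⟨e₀.map_source hx, by rw [e₀.left_inv hx]; exact h.flow.zero_mem x⟩
    obtain ⟨ε, hε, hball⟩ := Metric.mem_nhds_iff.1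
      ((isOpen_flowDomain h.flow.isOpen).mem_nhds hG)
    rw [← ball_prod_same] at hball
    -- One radius serves for all small `t`, so near `x` the functions `t ↦ σ_t(y)` and `t ↦ σ_t(x)`
    -- agree around `0` and have the same derivative there.
    have hconst : ∀ t ∈ Metric.ball (0 : ℝ) ε, ∀ z ∈ Metric.ball (e₀ x) ε,
        σ t (e₀.symm z) = σ t x := by
      intro t ht z hz
      have hder := fun w hw => h.hasFDerivAt_factor hβ hβ0 hm0 hm1 hF he₀
        (hball (show (t, w) ∈ _ from ⟨ht, hw⟩))
      have := Metric.isOpen_ball.is_const_of_fderiv_eq_zero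
        (convex_ball (e₀ x) ε).isPreconnected
        (fun w hw => (hder w hw).differentiableAt.differentiableWithinAt)
        (fun w hw => (hder w hw).fderiv) hz (Metric.mem_ball_self hε)
      simpa only [e₀.left_inv hx] using this
    filter_upwards [e₀.open_source.mem_nhds hx,
      (e₀.continuousAt hx).eventually_mem (Metric.ball_mem_nhds _ hε)] with y hy hyb
    refine (hc y).unique ((hc x).congr_of_eventuallyEq ?_)
    filter_upwards [Metric.ball_mem_nhds (0 : ℝ) hε] with t ht
    have := hconst t ht _ hyb
    rwa [e₀.left_inv hy] at this
  obtain ⟨x₀⟩ := (inferInstance : Nonempty M)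
  refine ⟨c x₀, D, Φ, σ, h, fun x => ?_⟩
  have hcx : c x = c x₀ := hloc.apply_eq_of_preconnectedSpace x x₀
  rw [← hcx]
  exact hc x
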